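/- Let $q>2$ be a prime power. For a point $P$ of ${\rm PG}(2,q^2)$, i.e. a one-dimensional subspace of ${\rm GF}(q^2)^3$, let $\phi(P)$ be the line of ${\rm PG}(5,q)$ obtained by regarding ${\rm GF}(q^2)^3$ as a six-dimensional vector space over ${\rm GF}(q)$ and $P$ as a two-dimensional subspace of it. A \emph{degenerate Hermitian curve} of ${\rm PG}(2,q^2)$ is a cone (union of the $q+1$ lines joining the vertex to the base) having as vertex a point and as base a Baer subline (a subline of order $q$) of a line not through the vertex. A linear code is \emph{minimal} if, for each of its non-zero codewords $u$, every codeword whose support is contained in that of $u$ is a scalar multiple of $u$; a minimal code is \emph{reduced} if deleting any one coordinate from all codewords gives a code that is not minimal. For a set $\mathcal B$ of $n$ points of ${\rm PG}(5,q)$, a code corresponding to $\mathcal B$ is one generated by the rows of a $6\times n$ matrix over ${\rm GF}(q)$ whose columns are coordinate vectors of the points of $\mathcal B$, each point being used exactly once. Let $A_w$ be the number of codewords of weight $w$. For a set $\mathcal P$ of seven points of ${\rm PG}(2,q^2)$, consider the following assertion. $(\ast)$ The set $\mathcal B$ of the points of ${\rm PG}(5,q)$ on the seven lines $\phi(P)$,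 $P\in\mathcal P$, has size $7(q+1)$, and each code corresponding to $\mathcal B$ is a $[7(q+1),6]_q$ reduced minimal linear code; the set of weights of its non-zero codewords is $\{5q,6q,7q\}$, and $$A_{5q}=21(q^2-1),\qquad A_{6q}=7(q^2-5)(q^2-1),\qquad A_{7q}=(q^4-6q^2+15)(q^2-1).$$ For $x\in{\rm GF}(q)\setminus\{0,1\}$ and $\xi\in{\rm GF}(q^2)\setminus{\rm GF}(q)$ let $$\mathcal P_{x,\xi}=\{(1,0,0),(0,1,0),(0,0,1),(1,1,1),(1,x,\xi x),(\xi x,1,x),(x,\xi x,1)\}\subset{\rm PG}(2,q^2).$$ 1. For all such $x,\xi$ for which $\mathcal P_{x,\xi}$ consists of seven points and is contained in no degenerate Hermitian curve, $\mathcal P=\mathcal P_{x,\xi}$ satisfies $(\ast)$. 2. If $q\neq 4$, then there are $x,\xi$ as in 1. 3. If $q=4$, then there is a set $\mathcal P$ of seven points of ${\rm PG}(2,q^2)$ that is contained in no degenerate Hermitian curve and satisfies $(\ast)$. -/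

import Mathlib

open scoped LinearAlgebra.Projectivization

namespace SevenLines

section Codes

variable {F ι : Type*} [Field F]

/-- A codeword `u` of `C` is minimal if it is non-zero and every codeword whose support is
contained in the support of `u` is a multiple of `u`. -/
def IsMinimalCodeword (C : Submodule F (ι → F)) (u : ι → F) : Prop :=
  u ∈ C ∧ u ≠ 0 ∧
    ∀ u' ∈ C, Function.support u' ⊆ Function.support u → ∃ c : F, u' = c • u

/-- A linear code is minimal if all its non-zero codewords are minimal. -/
def IsMinimalCode (C : Submodule F (ι → F)) : Prop :=
  ∀ u ∈ C, u ≠ 0 → IsMinimalCodeword C u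

/-- The code obtained from `C` by deleting the `i`-th coordinate of each codeword. -/
def puncture (C : Submodule F (ι → F)) (i : ι) : Submodule F ({j : ι // j ≠ i} → F) :=
  C.map (LinearMap.funLeft F F (Subtype.val : {j : ι // j ≠ i} → ι))

/-- A reduced minimal code: it is minimal, and no code obtained from it by deleting one
coordinate is minimal. -/
def IsReducedMinimalCode (C : Submodule F (ι → F)) : Prop :=
  IsMinimalCode C ∧ ∀ i : ι, ¬ IsMinimalCode (puncture C i)

/-- The set of weights of the non-zero codewords of `C`. -/
def nonzeroWeights [Fintype ι] [DecidableEq F] (C : Submodule F (ι → F)) : Set ℕ :=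
  {w | ∃ u ∈ C, u ≠ 0 ∧ hammingNorm u = w}

/-- The term `A_w` of the weight distribution of `C`: the number of codewords of weight `w`. -/
noncomputable def weightCount [Fintype ι] [DecidableEq F] (C : Submodule F (ι → F)) (w : ℕ) : ℕ :=
  {u : ι → F | u ∈ C ∧ hammingNorm u = w}.ncard

/-- `C` is a code of length `n` corresponding to the set `B` of points of the projective space of
the `k`-dimensional space `V`: it is generated by the rows of a `k × n` matrix whose columns are the
coordinate vectors, in some basis of `V`, of representatives of the points of `B`, each point
being used exactly once. -/
def IsCodeOf {V : Type*} [AddCommGroup V] [Module F V] (k n : ℕ) (B : Set (ℙ F V))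
    (C : Submodule F (Fin n → F)) : Prop :=
  ∃ (b : Module.Basis (Fin k) F V) (v : Fin n → V) (hv : ∀ j, v j ≠ 0),
    Set.BijOn (fun j => Projectivization.mk F (v j) (hv j)) Set.univ B ∧
    C = Submodule.span F
      (Set.range (Matrix.of fun (i : Fin k) (j : Fin n) => b.repr (v j) i).row)

end Codes

section Geometry

variable (F : Type*) {K : Type*} [Field F] [Field K] [Algebra F K]

/-- Field reduction: the set of points of `PG(5, q)`, the projective space of `K³` regarded as
a vector space over `F`, lying on the line that corresponds to the point `P` of `PG(2, q²)`. -/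
def fieldReduction (P : ℙ K (Fin 3 → K)) : Set (ℙ F (Fin 3 → K)) :=
  {R | R.submodule ≤ P.submodule.restrictScalars F}

/-- The set of points of `PG(5, q)` on the lines corresponding to the points of `S`. -/
def linePoints (S : Set (ℙ K (Fin 3 → K))) : Set (ℙ F (Fin 3 → K)) :=
  ⋃ P ∈ S, fieldReduction F P

/-- The Baer subline of the line through `⟨u⟩` and `⟨w⟩` consisting of the points `⟨s u + t w⟩`
with `s, t ∈ F` not both zero. Every Baer subline is of this form with `u, w` independent. -/
def baerSubline (u w : Fin 3 → K) : Set (ℙ K (Fin 3 → K)) :=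
  {R | ∃ s t : F, (s ≠ 0 ∨ t ≠ 0) ∧
    R.submodule = Submodule.span K {algebraMap F K s • u + algebraMap F K t • w}}

/-- A degenerate Hermitian curve (of rank 2) of `PG(2, q²)`: a cone whose vertex is a point `⟨v⟩`
and whose base is a Baer subline of a line not through the vertex. -/
def IsDegenerateHermitianCurve (H : Set (ℙ K (Fin 3 → K))) : Prop :=
  ∃ v u w : Fin 3 → K, LinearIndependent K ![v, u, w] ∧
    H = {X | ∃ R ∈ baerSubline F u w, X.submodule ≤ Submodule.span K {v} ⊔ R.submodule}

/-- A set of seven points of `PG(2, q²)` contained in no degenerate Hermitian curve. -/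
def IsSevenSet (S : Set (ℙ K (Fin 3 → K))) : Prop :=
  S.ncard = 7 ∧ ∀ H, IsDegenerateHermitianCurve F H → ¬ S ⊆ H

/-- The points `(1,0,0)`, `(0,1,0)`, `(0,0,1)`, `(1,1,1)`, `(1,x,ξx)`, `(ξx,1,x)`, `(x,ξx,1)`
of `PG(2, q²)`, where `x ∈ GF(q)` and `ξ ∈ GF(q²)`. -/
def pointSet {F : Type*} [Field F] [Algebra F K] (x : F) (ξ : K) : Set (ℙ K (Fin 3 → K)) :=
  let a : K := algebraMap F K x
  {P | ∃ v ∈ ({![1, 0, 0], ![0, 1, 0], ![0, 0, 1], ![1, 1, 1],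
      ![1, a, ξ * a], ![ξ * a, 1, a], ![a, ξ * a, 1]} : Set (Fin 3 → K)),
    P.submodule = Submodule.span K {v}}

/-- `x ∈ GF(q) \ {0, 1}` and `ξ ∈ GF(q²) \ GF(q)` are such that the points of `pointSet x ξ` are
seven and no degenerate Hermitian curve contains them all. -/
def IsAdmissible {F : Type*} [Field F] [Algebra F K] (x : F) (ξ : K) : Prop :=
  x ≠ 0 ∧ x ≠ 1 ∧ ξ ∉ Set.range (algebraMap F K) ∧ IsSevenSet F (pointSet x ξ)

/-- The lines of `PG(5, q)` corresponding to the points of `S` cover `7(q+1)` points, and each code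
corresponding to this set of points is a `[7(q+1), 6]_q` reduced minimal linear code with
weights `5q`, `6q`, `7q` and the stated weight distribution. -/
def GivesSevenLinesCode [DecidableEq F] (S : Set (ℙ K (Fin 3 → K))) : Prop :=
  (linePoints F S).ncard = 7 * (Nat.card F + 1) ∧
  ∀ C : Submodule F (Fin (7 * (Nat.card F + 1)) → F), IsCodeOf 6 _ (linePoints F S) C →
    Module.finrank F C = 6 ∧
    IsReducedMinimalCode C ∧
    nonzeroWeights C = {5 * Nat.card F, 6 * Nat.card F, 7 * Nat.card F} ∧
    (weightCount C (5 * Nat.card F) : ℤ) = 21 * ((Nat.card F : ℤ) ^ 2 - 1) ∧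
    (weightCount C (6 * Nat.card F) : ℤ) =
      7 * ((Nat.card F : ℤ) ^ 2 - 5) * ((Nat.card F : ℤ) ^ 2 - 1) ∧
    (weightCount C (7 * Nat.card F) : ℤ) =
      ((Nat.card F : ℤ) ^ 4 - 6 * (Nat.card F : ℤ) ^ 2 + 15) * ((Nat.card F : ℤ) ^ 2 - 1)

end Geometry

end SevenLines

namespace SevenLines

/-! ### Cones over Baer sublines in terms of pairs of functionals -/

section Cones

variable {K : Type*} [Field K]

/-! Write `F` = GF(q), `K` = GF(q²). A cone over a Baer subline is the locus where two independent
functionals on `K³` have values proportional over `F`; `NoCone` says that no such locus contains all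
the points. For a fixed non-zero `F`-linear `g : K → F`, every codeword is `j ↦ g (a · v j)`
(`IsCodeOf.exists_eq_range`). If the word of `b` has its support inside that of `a`, non-degeneracy
of `(z, w) ↦ g (z * w)` makes `b · p i` an `F`-multiple of `a · p i` at each of the seven points,
and `NoCone` then makes `b` an `F`-multiple of `a`: the code is minimal.

Since `K³` has dimension 6 over `F`, rationality of a quotient can be imposed at any four points
(`exists_functional_quotient`). Hence three collinear points would leave only four others and
produce a cone; so each line meets the set in at most two points. A word has weight `q` times the
number of points off its line, and double counting gives the weight distribution.

For reducedness one needs, for each point, a pair of functionals with rational quotient at the other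
six (`HasReducingPair`). If `q ≥ 5` the dimension count supplies it; for `q = 3, 4` the six points
are joined in pairs by three concurrent lines.

For existence, a cone yields a singular skew-Hermitian matrix vanishing at the points. For suitable
`x`, the skew-Hermitian forms vanishing on the seven points are parametrised by `(a, b)` in `F²`,
and the determinant is a multiple of `a³ + 3a²b - b³ - c ab(a + b)`, a form invariant under `(a, b)
↦ (b, -a - b)`. Some `c` makes it anisotropic, and `x`, `ξ` are tuned to that `c`: with `x = -1` for
odd `q`, by an Artin–Schreier count for even `q ≥ 8`. If `q = 4`, each `x ≠ 0, 1` is a primitive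
cube root of unity and the set lies on a cone, so another cyclic set is used. -/

theorem exists_dual_family (e : Fin 3 → Fin 3 → K) (he : LinearIndependent K e) :
    ∃ f : Fin 3 → Fin 3 → K, LinearIndependent K f ∧
      (∀ i j, e i ⬝ᵥ f j = if i = j then 1 else 0) ∧
      ∀ x, x = ∑ i, (e i ⬝ᵥ x) • f i := by
  have hu : IsUnit (Matrix.of e) := Matrix.linearIndependent_rows_iff_isUnit.1 he
  have hd : IsUnit (Matrix.of e).det := (Matrix.isUnit_iff_isUnit_det _).1 hu
  have h1 := Matrix.mul_nonsing_inv _ hd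
  have h2 := Matrix.nonsing_inv_mul _ hd
  refine ⟨fun j k => (Matrix.of e)⁻¹ k j, ?_, fun i j => ?_, fun x => ?_⟩
  · have : IsUnit (Matrix.transpose (Matrix.of e)⁻¹) :=
      (Matrix.isUnit_transpose _).2 (Matrix.isUnit_nonsing_inv_iff.2 hu)
    exact Matrix.linearIndependent_rows_iff_isUnit.2 this
  · have := congrFun (congrFun h1 i) j
    rw [Matrix.one_apply] at this
    rw [← this]
    rfl
  · have : (Matrix.of e)⁻¹.mulVec ((Matrix.of e).mulVec x) = x := by
      rw [Matrix.mulVec_mulVec, h2, Matrix.one_mulVec]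
    funext k
    conv_lhs => rw [← this]
    simp [Matrix.mulVec, dotProduct, Finset.sum_apply, mul_comm]

variable (F : Type*) [Field F] [Algebra F K]

/-- No cone with a point as vertex and a Baer subline as base contains all points `⟨p i⟩`, in terms
of the coordinates given by a pair of independent functionals. -/
def NoCone {ι : Type*} (p : ι → Fin 3 → K) : Prop :=
  ∀ a b : Fin 3 → K, LinearIndependent K ![a, b] →
    ¬ ∀ i, ∃ s t : F, (s ≠ 0 ∨ t ≠ 0) ∧ s • (a ⬝ᵥ p i) = t • (b ⬝ᵥ p i)

variable {F} {ι : Type*} {p : ι → Fin 3 → K}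

/-- In coordinates dual to `v, u, w`, a point of the cone has its `u`- and `w`-coordinates in the
ratio `s : t` given by its base point. -/
theorem NoCone.not_subset (h : NoCone F p) (hp : ∀ i, p i ≠ 0) {H : Set (ℙ K (Fin 3 → K))}
    (hH : IsDegenerateHermitianCurve F H) :
    ¬ Set.range (fun i => Projectivization.mk K (p i) (hp i)) ⊆ H := by
  rintro hs
  obtain ⟨v, u, w, hl, rfl⟩ := hH
  obtain ⟨f, hf, hd, -⟩ := exists_dual_family _ hl
  have h01 := hd 0 1; have h11 := hd 1 1; have h21 := hd 2 1
  have h02 := hd 0 2; have h12 := hd 1 2; have h22 := hd 2 2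
  simp at h01 h11 h21 h02 h12 h22
  refine h (f 1) (f 2) ?_ fun i => ?_
  · have := hf.comp ![1, 2] (by decide)
    convert this using 1
    funext i; fin_cases i <;> rfl
  · obtain ⟨R, ⟨s, t, hst, hR⟩, hX⟩ := hs ⟨i, rfl⟩
    rw [hR, Projectivization.submodule_mk, Submodule.span_singleton_le_iff_mem,
      Submodule.mem_sup] at hX
    obtain ⟨y, hy, z, hz, hyz⟩ := hX
    obtain ⟨k, rfl⟩ := Submodule.mem_span_singleton.1 hy
    obtain ⟨l, rfl⟩ := Submodule.mem_span_singleton.1 hz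
    refine ⟨t, s, hst.symm, ?_⟩
    rw [Algebra.smul_def t (f 1 ⬝ᵥ p i), Algebra.smul_def s (f 2 ⬝ᵥ p i), ← hyz]
    simp only [dotProduct_comm (f _), add_dotProduct, smul_dotProduct, h01, h11, h21, h02, h12,
      h22, smul_eq_mul]
    ring

/-- Completing `a, b` to a basis of functionals, the dual basis supplies the cone: the vertex is the
common zero `f 0` of `a` and `b`, and `f 1, f 2` span the base. -/
theorem noCone_of_not_subset (hp : ∀ i, p i ≠ 0)
    (h : ∀ H : Set (ℙ K (Fin 3 → K)), IsDegenerateHermitianCurve F H →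
      ¬ Set.range (fun i => Projectivization.mk K (p i) (hp i)) ⊆ H) : NoCone F p := by
  intro a b hab hcone
  obtain ⟨c, hc⟩ := exists_linearIndependent_cons_of_lt_finrank hab (by simp)
  obtain ⟨f, hf, -, hx⟩ := exists_dual_family _ hc
  refine h _ ⟨f 0, f 1, f 2, ?_, rfl⟩ ?_
  · convert hf using 1
    funext i; fin_cases i <;> rfl
  rintro _ ⟨i, rfl⟩
  obtain ⟨s, t, hst, he⟩ := hcone i
  have hpi := hx (p i)
  simp only [Fin.sum_univ_three] at hpi
  change p i = (c ⬝ᵥ p i) • f 0 + (a ⬝ᵥ p i) • f 1 + (b ⬝ᵥ p i) • f 2 at hpi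
  have hind : ∀ s t : F, s ≠ 0 ∨ t ≠ 0 →
      algebraMap F K s • f 1 + algebraMap F K t • f 2 ≠ 0 := by
    intro s t hst h0
    have hf' : LinearIndependent K ![f 1, f 2] := by
      have := hf.comp ![1, 2] (by decide)
      convert this using 1
      funext i; fin_cases i <;> rfl
    have := LinearIndependent.pair_iff.1 hf' _ _ h0
    simp at this
    tauto
  obtain ⟨k, hk1, hk2⟩ : ∃ k : K, a ⬝ᵥ p i = k * algebraMap F K t ∧
      b ⬝ᵥ p i = k * algebraMap F K s := by
    rw [Algebra.smul_def, Algebra.smul_def] at he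
    by_cases hs : s = 0
    · have ht : t ≠ 0 := by tauto
      subst hs
      have ht' : algebraMap F K t ≠ 0 := by simpa using ht
      refine ⟨(a ⬝ᵥ p i) / algebraMap F K t, by field_simp, ?_⟩
      simp [ht] at he
      simp [he]
    · have hs' : algebraMap F K s ≠ 0 := by simpa using hs
      refine ⟨(b ⬝ᵥ p i) / algebraMap F K s, ?_, by field_simp⟩
      field_simp
      linear_combination he
  refine ⟨Projectivization.mk K _ (hind t s hst.symm), ⟨t, s, hst.symm, ?_⟩, ?_⟩
  · rw [Projectivization.submodule_mk]
  · rw [Projectivization.submodule_mk, Projectivization.submodule_mk,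
      Submodule.span_singleton_le_iff_mem, hpi, hk1, hk2]
    refine Submodule.mem_sup.2 ⟨(c ⬝ᵥ p i) • f 0,
      Submodule.smul_mem _ _ (Submodule.mem_span_singleton_self _),
      k • (algebraMap F K t • f 1 + algebraMap F K s • f 2),
      Submodule.smul_mem _ _ (Submodule.mem_span_singleton_self _), ?_⟩
    module

end Cones

/-! ### Consequences of the dimension count: arcs and reducing pairs -/

section Arcs

variable {F K : Type*} [Field F] [Field K] [Algebra F K]

/-- For at most four vectors and a functional `c` there is a functional `d`, not a multiple of
`c` by an element of `F`, whose quotient by `c` takes values in `F` on these vectors. -/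
theorem exists_functional_quotient (hK : Module.finrank F K = 2) {κ : Type*} [Fintype κ]
    (hκ : Fintype.card κ ≤ 4) (x : κ → Fin 3 → K) (c : Fin 3 → K) :
    ∃ d : Fin 3 → K, (∀ s : F, d ≠ s • c) ∧
      ∀ i, c ⬝ᵥ x i ≠ 0 → ∃ s : F, d ⬝ᵥ x i = s • (c ⬝ᵥ x i) := by
  have hfin : FiniteDimensional F K := Module.finite_of_finrank_pos (by omega)
  let W : Submodule F K := F ∙ (1 : K)
  have hW : Module.finrank F (K ⧸ W) = 1 := by
    have h1 := W.finrank_quotient_add_finrank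
    have h2 : Module.finrank F W = 1 := finrank_span_singleton one_ne_zero
    omega
  -- The source has dimension 6 over `F` and the target at most 4, so the kernel is larger than the
  -- line `F ∙ c`. Where `c` vanishes, division by zero gives 0 and no condition is imposed.
  let L : (Fin 3 → K) →ₗ[F] (κ → K ⧸ W) :=
    LinearMap.pi fun i => W.mkQ ∘ₗ
      { toFun := fun d => (d ⬝ᵥ x i) / (c ⬝ᵥ x i)
        map_add' := by intro a b; rw [add_dotProduct, add_div]
        map_smul' := by
          intro s a
          rw [smul_dotProduct, RingHom.id_apply, smul_div_assoc] }
  have hr := L.finrank_range_add_finrank_ker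
  have hle : Module.finrank F (LinearMap.range L) ≤ 4 := by
    refine (Submodule.finrank_le _).trans ?_
    rw [Module.finrank_pi_fintype]
    simpa [hW] using hκ
  rw [Module.finrank_pi_fintype, Finset.sum_const, hK] at hr
  simp only [Finset.card_univ, Fintype.card_fin, smul_eq_mul] at hr
  obtain ⟨d, hd, hdc⟩ : ∃ d ∈ LinearMap.ker L, d ∉ F ∙ c := by
    by_contra! hcon
    have h1 := Submodule.finrank_mono (show LinearMap.ker L ≤ F ∙ c from hcon)
    have h2 := finrank_span_le_card (R := F) ({c} : Set (Fin 3 → K))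
    simp at h2
    omega
  refine ⟨d, fun s hs => hdc (hs ▸ Submodule.smul_mem _ _ (Submodule.mem_span_singleton_self c)),
    fun i hi => ?_⟩
  have h0 := congrFun (LinearMap.mem_ker.1 hd) i
  have h1 : (d ⬝ᵥ x i) / (c ⬝ᵥ x i) ∈ W := (Submodule.Quotient.mk_eq_zero W).1 h0
  obtain ⟨s, hs⟩ := Submodule.mem_span_singleton.1 h1
  refine ⟨s, ?_⟩
  rw [Algebra.smul_def, mul_one] at hs
  rw [Algebra.smul_def, hs, div_mul_cancel₀ _ hi]

theorem linearIndependent_pair_of_ne_smul {c d : Fin 3 → K} (hc : c ≠ 0)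
    (h : ∀ l : K, d ≠ l • c) : LinearIndependent K ![c, d] :=
  (LinearIndependent.pair_iff' hc).2 fun l hl => h l hl.symm

theorem linearIndependent_pair_of_dotProduct_eq_smul {c d x : Fin 3 → K} (hx : c ⬝ᵥ x ≠ 0) {s : F}
    (hs : d ⬝ᵥ x = s • (c ⬝ᵥ x)) (hd : d ≠ s • c) : LinearIndependent K ![c, d] := by
  refine linearIndependent_pair_of_ne_smul (by rintro rfl; simp at hx) fun l hl => hd ?_
  rw [hl, smul_dotProduct, smul_eq_mul, Algebra.smul_def] at hs
  rw [hl, mul_right_cancel₀ hx hs, algebraMap_smul]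

theorem exists_linearIndependent_pair {c : Fin 3 → K} (hc : c ≠ 0) :
    ∃ d, LinearIndependent K ![c, d] := by
  have : (K ∙ c) ≠ ⊤ := fun h => by
    have h2 := finrank_span_le_card (R := K) ({c} : Set (Fin 3 → K))
    rw [h] at h2
    simp at h2
  obtain ⟨d, hd⟩ := SetLike.exists_not_mem_of_ne_top _ this rfl
  exact ⟨d, linearIndependent_pair_of_ne_smul hc fun l hl =>
    hd (hl ▸ Submodule.smul_mem _ _ (Submodule.mem_span_singleton_self c))⟩

variable {ι : Type*} {p : ι → Fin 3 → K}

theorem NoCone.exists_dotProduct_ne_zero (h : NoCone F p) {c : Fin 3 → K} (hc : c ≠ 0) :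
    ∃ i, c ⬝ᵥ p i ≠ 0 := by
  by_contra! h0
  obtain ⟨d, hd⟩ := exists_linearIndependent_pair hc
  exact h c d hd fun i => ⟨1, 0, by simp, by simp [h0 i]⟩

open Classical in
-- A line through three of the points leaves at most four, on which some `d` has rational quotient
-- by `c`; then `c, d` define a cone through all seven.
theorem NoCone.card_filter_le {p : Fin 7 → Fin 3 → K} (hK : Module.finrank F K = 2)
    (h : NoCone F p) {c : Fin 3 → K} (hc : c ≠ 0) :
    (Finset.univ.filter fun i => c ⬝ᵥ p i = 0).card ≤ 2 := by
  by_contra! hcard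
  have hsum := Finset.card_filter_add_card_filter_not (s := (Finset.univ : Finset (Fin 7)))
    (fun i => c ⬝ᵥ p i = 0)
  rw [Finset.card_univ, Fintype.card_fin] at hsum
  obtain ⟨d, hd, hq⟩ := exists_functional_quotient (F := F) hK
    (κ := {i : Fin 7 // c ⬝ᵥ p i ≠ 0}) (by
      rw [Fintype.card_subtype]
      change Finset.card (Finset.univ.filter fun i => ¬ c ⬝ᵥ p i = 0) ≤ 4
      omega) (fun i => p i) c
  obtain ⟨i₀, hi₀⟩ := h.exists_dotProduct_ne_zero hc
  obtain ⟨s, hs⟩ := hq ⟨i₀, hi₀⟩ hi₀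
  refine h c d (linearIndependent_pair_of_dotProduct_eq_smul hi₀ hs (hd s)) fun i => ?_
  · by_cases hi : c ⬝ᵥ p i = 0
    · exact ⟨1, 0, by simp, by simp [hi]⟩
    · obtain ⟨s, hs⟩ := hq ⟨i, hi⟩ hi
      exact ⟨s, 1, by simp, by simpa using hs.symm⟩

variable (F) in
/-- Two independent functionals `a`, `b` such that `b` is proportional to `a` over `F` on each
`p i` with `i ≠ i₀`. -/
def HasReducingPair (p : ι → Fin 3 → K) (i₀ : ι) : Prop :=
  ∃ a b : Fin 3 → K, LinearIndependent K ![a, b] ∧ ∀ i ≠ i₀, ∃ t : F, b ⬝ᵥ p i = t • (a ⬝ᵥ p i)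

theorem NoCone.eq_of_dotProduct_eq_zero {p : Fin 7 → Fin 3 → K} (hK : Module.finrank F K = 2)
    (h : NoCone F p) {c : Fin 3 → K} (hc : c ≠ 0) {i j k : Fin 7} (hij : i ≠ j)
    (hi : c ⬝ᵥ p i = 0) (hj : c ⬝ᵥ p j = 0) (hk : c ⬝ᵥ p k = 0) : k = i ∨ k = j := by
  classical
  by_contra! hne
  have h1 := h.card_filter_le hK hc
  have h2 : ({i, j, k} : Finset (Fin 7)).card = 3 := Finset.card_eq_three.2
    ⟨i, j, k, hij, hne.1.symm, hne.2.symm, rfl⟩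
  have h3 : ({i, j, k} : Finset (Fin 7)) ⊆ Finset.univ.filter fun i => c ⬝ᵥ p i = 0 := by
    intro x hx
    simp only [Finset.mem_insert, Finset.mem_singleton] at hx
    simp only [Finset.mem_filter, Finset.mem_univ, true_and]
    rcases hx with rfl | rfl | rfl <;> assumption
  have := Finset.card_le_card h3
  omega

theorem exists_ne_zero_dotProduct_eq_zero (x y : Fin 3 → K) :
    ∃ c : Fin 3 → K, c ≠ 0 ∧ c ⬝ᵥ x = 0 ∧ c ⬝ᵥ y = 0 := by
  obtain ⟨c, hc, h⟩ := Matrix.exists_mulVec_eq_zero_iff.2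
    (show (Matrix.of ![x, y, 0]).det = 0 from Matrix.det_eq_zero_of_row_eq_zero 2 fun _ => rfl)
  refine ⟨c, hc, ?_, ?_⟩
  · rw [dotProduct_comm]; exact congrFun h 0
  · rw [dotProduct_comm]; exact congrFun h 1

/-- If two of the vectors were dependent, some line through both and a third point would contain
three of the seven. -/
theorem NoCone.linearIndependent {p : Fin 7 → Fin 3 → K} (hK : Module.finrank F K = 2)
    (h : NoCone F p) {i j : Fin 7} (hij : i ≠ j) : LinearIndependent K ![p i, p j] := by
  obtain ⟨k, hki, hkj⟩ : ∃ k : Fin 7, k ≠ i ∧ k ≠ j := by decide +revert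
  by_contra hl
  rw [LinearIndependent.pair_iff] at hl
  push Not at hl
  obtain ⟨s, t, hst, hne⟩ := hl
  by_cases hs : s = 0
  · have ht : t ≠ 0 := hne hs
    have hj0 : p j = 0 := by simpa [hs, ht] using hst
    obtain ⟨c, hc, h1, h2⟩ := exists_ne_zero_dotProduct_eq_zero (p i) (p k)
    have := h.eq_of_dotProduct_eq_zero hK hc hij h1 (by simp [hj0]) h2
    tauto
  · obtain ⟨c, hc, h1, h2⟩ := exists_ne_zero_dotProduct_eq_zero (p j) (p k)
    have h3 : c ⬝ᵥ p i = 0 := by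
      have := congrArg (c ⬝ᵥ ·) hst
      simpa [dotProduct_add, dotProduct_smul, h1, hs] using this
    have := h.eq_of_dotProduct_eq_zero hK hc hij h3 h1 h2
    tauto

theorem NoCone.hasReducingPair [Finite F] {p : Fin 7 → Fin 3 → K} (hK : Module.finrank F K = 2)
    (h : NoCone F p) (hF : 5 ≤ Nat.card F) (i₀ : Fin 7) : HasReducingPair F p i₀ := by
  classical
  have := Fintype.ofFinite F
  obtain ⟨i₁, i₂, h01, h02, h12⟩ : ∃ i₁ i₂ : Fin 7, i₁ ≠ i₀ ∧ i₂ ≠ i₀ ∧ i₁ ≠ i₂ := by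
    decide +revert
  obtain ⟨c, hc, hc1, hc2⟩ := exists_ne_zero_dotProduct_eq_zero (p i₁) (p i₂)
  have hκ : Fintype.card {i : Fin 7 // i ≠ i₀ ∧ i ≠ i₁ ∧ i ≠ i₂} = 4 := by
    clear hc1 hc2
    decide +revert
  obtain ⟨d, hd, hq⟩ := exists_functional_quotient (F := F) hK hκ.le (fun i => p i) c
  have hne (i : Fin 7) (hi1 : i ≠ i₁) (hi2 : i ≠ i₂) : c ⬝ᵥ p i ≠ 0 := fun h0 => by
    have := h.eq_of_dotProduct_eq_zero hK hc h12 hc1 hc2 h0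
    tauto
  choose s hs using fun i : {i : Fin 7 // i ≠ i₀ ∧ i ≠ i₁ ∧ i ≠ i₂} =>
    hq i (hne i i.2.2.1 i.2.2.2)
  -- There are four quotients to avoid, whence the bound `q ≥ 5`.
  obtain ⟨t, ht⟩ : ∃ t : F, ∀ i, s i ≠ t := by
    have hlt : (Finset.univ.image s).card < (Finset.univ : Finset F).card := by
      have := Finset.card_image_le (s := Finset.univ) (f := s)
      rw [Finset.card_univ, hκ] at this
      rw [Finset.card_univ, ← Nat.card_eq_fintype_card]
      omega
    obtain ⟨t, -, ht⟩ := Finset.exists_mem_notMem_of_card_lt_card hlt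
    exact ⟨t, fun i hi => ht (Finset.mem_image.2 ⟨i, Finset.mem_univ _, hi⟩)⟩
  obtain ⟨⟨i₃, h3⟩⟩ := Fintype.card_pos_iff.1 (hκ.symm ▸ four_pos)
  have hli : LinearIndependent K ![c, d] :=
    linearIndependent_pair_of_dotProduct_eq_smul (hne i₃ h3.2.1 h3.2.2) (hs ⟨i₃, h3⟩) (hd _)
  -- Subtracting `t • c` makes the denominator non-zero at the four points, where the quotient
  -- becomes `(s i - t)⁻¹`; at `i₁` and `i₂` the numerator `c` vanishes.
  refine ⟨d - algebraMap F K t • c, c, ?_, fun i hi => ?_⟩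
  · rw [LinearIndependent.pair_iff] at hli ⊢
    intro x y hxy
    have := hli (y - x * algebraMap F K t) x (by rw [← hxy]; module)
    obtain ⟨h1, rfl⟩ := this
    simpa using h1
  · by_cases hi1 : i = i₁
    · exact ⟨0, by simp [hi1, hc1]⟩
    by_cases hi2 : i = i₂
    · exact ⟨0, by simp [hi2, hc2]⟩
    have h1 := hs ⟨i, hi, hi1, hi2⟩
    have h2 := sub_ne_zero.2 (ht ⟨i, hi, hi1, hi2⟩)
    refine ⟨(s ⟨i, hi, hi1, hi2⟩ - t)⁻¹, ?_⟩
    rw [sub_dotProduct, smul_dotProduct, h1, smul_eq_mul, Algebra.smul_def, Algebra.smul_def,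
      ← sub_mul, ← map_sub, ← mul_assoc, ← map_mul, inv_mul_cancel₀ h2, map_one, one_mul]

end Arcs

/-! ### Codewords as traces of functionals, and their weights -/

section Words

variable {F K : Type*} [Field F] [Field K] [Algebra F K] {ι : Type*}

/-- The `F`-valued functional `x ↦ g (a · x)` on `K³`. -/
def functionalOf (g : K →ₗ[F] F) : (Fin 3 → K) →ₗ[F] Module.Dual F (Fin 3 → K) where
  toFun a := g ∘ₗ
    { toFun := fun x => a ⬝ᵥ x
      map_add' := dotProduct_add a
      map_smul' := fun s x => dotProduct_smul s a x }
  map_add' a b := by ext x; simp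
  map_smul' s a := by ext x; simp

theorem functionalOf_apply (g : K →ₗ[F] F) (a x : Fin 3 → K) :
    functionalOf g a x = g (a ⬝ᵥ x) := rfl

theorem eq_zero_of_forall_mul {g : K →ₗ[F] F} (hg : g ≠ 0) {w : K} (h : ∀ k, g (k * w) = 0) :
    w = 0 := by
  by_contra hw
  refine hg (LinearMap.ext fun z => ?_)
  simpa [hw] using h (z / w)

theorem functionalOf_injective {g : K →ₗ[F] F} (hg : g ≠ 0) :
    Function.Injective (functionalOf g) := by
  rw [injective_iff_map_eq_zero]
  intro a ha
  funext i
  refine eq_zero_of_forall_mul hg fun k => ?_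
  have := LinearMap.congr_fun ha (Pi.single i k)
  rw [functionalOf_apply, dotProduct_single, mul_comm] at this
  exact this

/-- An injective map between `F`-spaces of equal finite dimension; thus every `F`-functional on `K³`
comes from a `K`-functional through the single `g`. -/
theorem functionalOf_surjective [FiniteDimensional F K] {g : K →ₗ[F] F} (hg : g ≠ 0) :
    Function.Surjective (functionalOf g) :=
  (LinearMap.injective_iff_surjective_of_finrank_eq_finrank
    (Subspace.dual_finrank_eq (K := F) (V := Fin 3 → K)).symm).1 (functionalOf_injective hg)

/-- The codeword with entries `g (a · v j)`. -/
def word (g : K →ₗ[F] F) (v : ι → Fin 3 → K) : (Fin 3 → K) →ₗ[F] (ι → F) :=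
  (LinearMap.pi fun j => Module.Dual.eval F _ (v j)) ∘ₗ functionalOf g

theorem word_apply (g : K →ₗ[F] F) (v : ι → Fin 3 → K) (a : Fin 3 → K) (j : ι) :
    word g v a j = g (a ⬝ᵥ v j) := rfl

/-- The rows are the dual basis vectors evaluated at the columns, so the row space is the evaluation
of the whole dual space, whatever the basis. -/
theorem IsCodeOf.exists_eq_range [FiniteDimensional F K] {g : K →ₗ[F] F} (hg : g ≠ 0) {k n : ℕ}
    {B : Set (ℙ F (Fin 3 → K))} {C : Submodule F (Fin n → F)} (h : IsCodeOf k n B C) :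
    ∃ (v : Fin n → Fin 3 → K) (hv : ∀ j, v j ≠ 0),
      Set.BijOn (fun j => Projectivization.mk F (v j) (hv j)) Set.univ B ∧
      C = LinearMap.range (word g v) := by
  obtain ⟨b, v, hv, hb, rfl⟩ := h
  refine ⟨v, hv, hb, ?_⟩
  let E : Module.Dual F (Fin 3 → K) →ₗ[F] (Fin n → F) :=
    LinearMap.pi fun j => Module.Dual.eval F _ (v j)
  have h1 : Set.range (Matrix.of fun (i : Fin k) (j : Fin n) => b.repr (v j) i).row =
      E '' Set.range b.dualBasis := by
    rw [← Set.range_comp]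
    congr 1
    funext i j
    simp [E, Matrix.row]
  rw [h1, ← Submodule.map_span, b.dualBasis.span_eq, word, LinearMap.range_comp,
    LinearMap.range_eq_top.2 (functionalOf_surjective hg)]

variable (F) in
/-- Coordinates on the points of the lines `φ⟨p i⟩`: the non-zero multiples over `F` of the vectors
`v j` are exactly the non-zero multiples over `K` of the vectors `p i`. -/
def IsCoordinates {m : ℕ} (p : Fin m → Fin 3 → K) (v : ι → Fin 3 → K) (e : ι × Fˣ ≃ Fin m × Kˣ) :
    Prop :=
  ∀ x, (x.2 : F) • v x.1 = ((e x).2 : K) • p (e x).1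

theorem mk_mem_linePoints {m : ℕ} {p : Fin m → Fin 3 → K} (hp : ∀ i, p i ≠ 0) {x : Fin 3 → K}
    (hx : x ≠ 0) :
    Projectivization.mk F x hx ∈ linePoints F
      (Set.range fun i => Projectivization.mk K (p i) (hp i)) ↔
    ∃ (i : Fin m) (k : Kˣ), x = (k : K) • p i := by
  simp only [linePoints, fieldReduction, Set.biUnion_range, Set.mem_iUnion, Set.mem_ofPred_eq,
    Projectivization.submodule_mk, Submodule.span_singleton_le_iff_mem,
    Submodule.restrictScalars_mem, Submodule.mem_span_singleton]
  refine exists_congr fun i => ⟨?_, ?_⟩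
  · rintro ⟨k, rfl⟩
    exact ⟨Units.mk0 k (by rintro rfl; simp at hx), rfl⟩
  · rintro ⟨k, rfl⟩
    exact ⟨k, rfl⟩

/-- Both products enumerate, without repetition, the non-zero vectors on the lines: once as
`F`-multiples of columns, once as `K`-multiples of the `p i`. -/
theorem exists_isCoordinates {m : ℕ} {p : Fin m → Fin 3 → K} (hp : ∀ i, p i ≠ 0)
    (hinj : Function.Injective fun i => Projectivization.mk K (p i) (hp i))
    {v : ι → Fin 3 → K} (hv : ∀ j, v j ≠ 0)
    (hb : Set.BijOn (fun j => Projectivization.mk F (v j) (hv j)) Set.univ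
      (linePoints F (Set.range fun i => Projectivization.mk K (p i) (hp i)))) :
    ∃ e : ι × Fˣ ≃ Fin m × Kˣ, IsCoordinates F p v e := by
  have h1 (x : ι × Fˣ) : ∃ y : Fin m × Kˣ, (x.2 : F) • v x.1 = (y.2 : K) • p y.1 := by
    obtain ⟨i, k, hk⟩ := (mk_mem_linePoints hp (hv x.1)).1 (hb.mapsTo (Set.mem_univ x.1))
    refine ⟨(i, Units.map (algebraMap F K) x.2 * k), ?_⟩
    simp only [Units.val_mul, Units.coe_map, MonoidHom.coe_coe, mul_smul, hk, algebraMap_smul]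
  choose f hf using h1
  refine ⟨Equiv.ofBijective f ⟨fun x y hxy => ?_, fun y => ?_⟩, hf⟩
  · have h2 : (x.2 : F) • v x.1 = (y.2 : F) • v y.1 := by rw [hf, hf, hxy]
    have h3 : x.1 = y.1 := by
      refine hb.injOn (Set.mem_univ _) (Set.mem_univ _) ?_
      refine (Projectivization.mk_eq_mk_iff' F _ _ _ _).2 ⟨(x.2 : F)⁻¹ * y.2, ?_⟩
      rw [mul_smul, ← h2, smul_smul, inv_mul_cancel₀ x.2.ne_zero, one_smul]
    refine Prod.ext h3 (Units.ext ?_)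
    rw [h3] at h2
    exact smul_left_injective F (hv _) h2
  · have hy : (y.2 : K) • p y.1 ≠ 0 := smul_ne_zero y.2.ne_zero (hp _)
    obtain ⟨j, -, hj⟩ := hb.surjOn ((mk_mem_linePoints (F := F) hp hy).2 ⟨y.1, y.2, rfl⟩)
    obtain ⟨s, hs⟩ := (Projectivization.mk_eq_mk_iff F _ _ _ _).1 hj.symm
    refine ⟨(j, s), ?_⟩
    have h2 := hf (j, s)
    have h4 : (y.2 : K) • p y.1 = ((f (j, s)).2 : K) • p (f (j, s)).1 := by
      rw [← h2, ← hs]; rfl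
    have h3 : y.1 = (f (j, s)).1 := by
      refine hinj ((Projectivization.mk_eq_mk_iff' K _ _ _ _).2
        ⟨(y.2 : K)⁻¹ * ((f (j, s)).2 : K), ?_⟩)
      rw [mul_smul, ← h4, smul_smul, inv_mul_cancel₀ y.2.ne_zero, one_smul]
    refine Prod.ext h3.symm (Units.ext ?_)
    rw [h3] at h4
    exact (smul_left_injective K (hp _) h4).symm

section Weights

/-- Multiplication by `w ≠ 0` permutes the non-zero elements of `K`, and the kernel of `g` has `q`
elements. -/
theorem card_filter_mul_ne_zero [Fintype F] [Fintype K] [DecidableEq F] [DecidableEq K]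
    (hK : Module.finrank F K = 2) {g : K →ₗ[F] F}
    (hg : g ≠ 0) (w : K) :
    (Finset.univ.filter fun k : Kˣ => g (k * w) ≠ 0).card =
      if w ≠ 0 then Fintype.card F ^ 2 - Fintype.card F else 0 := by
  have hfin : FiniteDimensional F K := Module.finite_of_finrank_pos (by omega)
  by_cases hw : w = 0
  · simp [hw]
  rw [if_pos hw]
  have h1 : (Finset.univ.filter fun k : Kˣ => g (k * w) ≠ 0).card =
      (Finset.univ.filter fun z : K => ¬ g z = 0).card := by
    refine Finset.card_nbij (fun k => (k : K) * w) ?_ ?_ ?_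
    · intro k hk
      simpa using hk
    · intro k _ l _ h
      exact Units.ext (mul_right_cancel₀ hw h)
    · intro z hz
      have hz' : g z ≠ 0 := by simpa using hz
      have hz0 : z ≠ 0 := by rintro rfl; simp at hz'
      refine ⟨Units.mk0 (z / w) (div_ne_zero hz0 hw), ?_, ?_⟩
      · simpa [hw] using hz'
      · simp [hw]
  have h2 := Finset.card_filter_add_card_filter_not (s := (Finset.univ : Finset K))
    (fun z => g z = 0)
  have h3 : (Finset.univ.filter fun z : K => g z = 0).card = Fintype.card F := by
    have hs : LinearMap.range g = ⊤ := LinearMap.range_eq_top.2 (LinearMap.surjective hg)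
    have h4 := g.finrank_range_add_finrank_ker
    rw [hs, finrank_top, Module.finrank_self, hK] at h4
    have := Fintype.ofFinite (LinearMap.ker g)
    have h5 := Module.card_eq_pow_finrank (K := F) (V := LinearMap.ker g)
    rw [show Module.finrank F (LinearMap.ker g) = 1 by omega, pow_one] at h5
    rw [← h5, ← Fintype.card_subtype]
    exact Fintype.card_congr (Equiv.refl _)
  rw [Finset.card_univ, Module.card_eq_pow_finrank (K := F) (V := K), hK] at h2
  omega

open Classical in
theorem IsCoordinates.hammingNorm_word [Finite F] [Fintype ι] [DecidableEq F] (hK : Module.finrank F K = 2)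
    {g : K →ₗ[F] F} (hg : g ≠ 0) {m : ℕ} {p : Fin m → Fin 3 → K} {v : ι → Fin 3 → K}
    {e : ι × Fˣ ≃ Fin m × Kˣ} (he : IsCoordinates F p v e) (a : Fin 3 → K) :
    hammingNorm (word g v a) =
      Nat.card F * (Finset.univ.filter fun i => a ⬝ᵥ p i ≠ 0).card := by
  have := Fintype.ofFinite F
  have hfin : FiniteDimensional F K := Module.finite_of_finrank_pos (by omega)
  have := Module.finite_of_finite F (M := K)
  have := Fintype.ofFinite K
  have hq : 1 < Fintype.card F := Fintype.one_lt_card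
  -- Non-zero values are counted over all vectors on the lines: each non-zero entry contributes `q -
  -- 1`, each point with `a · p i ≠ 0` contributes `q² - q`.
  have h1 : ∑ x : ι × Fˣ, (if g (a ⬝ᵥ ((x.2 : F) • v x.1)) ≠ 0 then 1 else 0) =
      ∑ y : Fin m × Kˣ, (if g (y.2 * (a ⬝ᵥ p y.1)) ≠ 0 then 1 else 0) := by
    rw [← Equiv.sum_comp e]
    refine Finset.sum_congr rfl fun x _ => ?_
    rw [he x, dotProduct_smul, smul_eq_mul]
  rw [Fintype.sum_prod_type, Fintype.sum_prod_type] at h1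
  have h2 (i : Fin m) : ∑ k : Kˣ, (if g (k * (a ⬝ᵥ p i)) ≠ 0 then 1 else 0) =
      if a ⬝ᵥ p i ≠ 0 then Fintype.card F ^ 2 - Fintype.card F else 0 := by
    rw [← Finset.card_filter, card_filter_mul_ne_zero hK hg]
  have h3 (j : ι) : ∑ c : Fˣ, (if g (a ⬝ᵥ ((c : F) • v j)) ≠ 0 then 1 else 0) =
      if word g v a j ≠ 0 then Fintype.card F - 1 else 0 := by
    by_cases hj : g (a ⬝ᵥ v j) = 0 <;>
      simp [dotProduct_smul, word_apply, Fintype.card_units, hj]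
  simp only [h2, h3, ← Finset.sum_filter, Finset.sum_const, smul_eq_mul] at h1
  have h4 : Fintype.card F ^ 2 - Fintype.card F = Fintype.card F * (Fintype.card F - 1) := by
    rw [Nat.mul_sub, sq, mul_one]
  rw [h4] at h1
  rw [Nat.card_eq_fintype_card, mul_comm]
  have h5 : hammingNorm (word g v a) = (Finset.univ.filter fun j => word g v a j ≠ 0).card := by
    unfold hammingNorm
    congr!
  rw [h5]
  refine Nat.eq_of_mul_eq_mul_right (show 0 < Fintype.card F - 1 by omega) ?_
  rw [h1]
  ring

theorem natCard_of_equiv_prod_units [Finite F] (hK : Module.finrank F K = 2) {m : ℕ}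
    (e : ι × Fˣ ≃ Fin m × Kˣ) :
    Nat.card ι = m * (Nat.card F + 1) := by
  have := Fintype.ofFinite F
  have hfin : FiniteDimensional F K := Module.finite_of_finrank_pos (by omega)
  have := Module.finite_of_finite F (M := K)
  have hq : 1 < Nat.card F := Finite.one_lt_card
  have h1 := Nat.card_congr e
  rw [Nat.card_prod, Nat.card_prod, Nat.card_units, Nat.card_units,
    Module.natCard_eq_pow_finrank (K := F) (V := K), hK, Nat.card_fin] at h1
  refine Nat.eq_of_mul_eq_mul_right (show 0 < Nat.card F - 1 by omega) ?_
  rw [h1, mul_assoc]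
  congr 1
  zify [hq.le, Nat.one_le_pow 2 _ (by omega : 0 < Nat.card F)]
  ring

end Weights

end Words

/-! ### Counting lines by their number of points in the set -/

section Counting

variable {F K : Type*} [Field F] [Finite F] [Field K] [Algebra F K]

theorem natCard_dotProduct_eq_zero (hK : Module.finrank F K = 2) {k : ℕ} {x : Fin k → Fin 3 → K}
    (hx : LinearIndependent K x) :
    Nat.card {a : Fin 3 → K // ∀ j, a ⬝ᵥ x j = 0} = (Nat.card F ^ 2) ^ (3 - k) := by
  have hfin : FiniteDimensional F K := Module.finite_of_finrank_pos (by omega)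
  have := Module.finite_of_finite F (M := K)
  have h1 := (Matrix.mulVecLin (Matrix.of x)).finrank_range_add_finrank_ker
  have h2 : (Matrix.of x).rank = Fintype.card (Fin k) := LinearIndependent.rank_matrix hx
  rw [Fintype.card_fin] at h2
  rw [← Matrix.rank, h2, Module.finrank_fin_fun] at h1
  have h3 := Module.natCard_eq_pow_finrank (K := K)
    (V := LinearMap.ker (Matrix.mulVecLin (Matrix.of x)))
  rw [Module.natCard_eq_pow_finrank (K := F) (V := K), hK,
    show Module.finrank K (LinearMap.ker (Matrix.mulVecLin (Matrix.of x))) = 3 - k by omega] at h3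
  rw [← h3]
  refine Nat.card_congr (Equiv.subtypeEquivRight fun a => ?_)
  rw [LinearMap.mem_ker, funext_iff]
  refine forall_congr' fun j => ?_
  rw [dotProduct_comm]
  rfl

open Classical in
/-- The number of points `⟨p i⟩` on the line with equation `a · x = 0`. -/
noncomputable def zeroCount {m : ℕ} (p : Fin m → Fin 3 → K) (a : Fin 3 → K) : ℕ :=
  (Finset.univ.filter fun i => a ⬝ᵥ p i = 0).card

/-- The functionals `a ≠ 0` with exactly `k` zeros among the points of an arc of size seven. -/
theorem card_zeroCount_eq [Fintype K] [DecidableEq K] (hK : Module.finrank F K = 2)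
    {p : Fin 7 → Fin 3 → K}
    (h : NoCone F p) (N : ℕ → ℕ) (hN : ∀ k, N k =
      ((Finset.univ.filter fun a : Fin 3 → K => a ≠ 0).filter fun a => zeroCount p a = k).card) :
    (N 2 : ℤ) = 21 * ((Nat.card F : ℤ) ^ 2 - 1) ∧
    (N 1 : ℤ) = 7 * ((Nat.card F : ℤ) ^ 2 - 5) * ((Nat.card F : ℤ) ^ 2 - 1) ∧
    (N 0 : ℤ) = ((Nat.card F : ℤ) ^ 4 - 6 * (Nat.card F : ℤ) ^ 2 + 15) *
      ((Nat.card F : ℤ) ^ 2 - 1) := by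
  set q := Nat.card F with hq
  set A : Finset (Fin 3 → K) := Finset.univ.filter fun a => a ≠ 0 with hA
  have hle (a) (ha : a ∈ A) : zeroCount p a ≤ 2 := by
    have := h.card_filter_le hK (Finset.mem_filter.1 ha).2
    unfold zeroCount
    convert this
  -- The zero functional is excluded from `A` but lies in every solution space, which accounts for
  -- the `+ 1` here and below.
  have herase (P : (Fin 3 → K) → Prop) [DecidablePred P] (h0 : P 0) :
      (A.filter P).card + 1 = Nat.card {a // P a} := by
    rw [Nat.card_eq_fintype_card, Fintype.card_subtype,
      ← Finset.card_erase_add_one (s := Finset.univ.filter P) (a := 0) (by simpa using h0)]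
    congr 2
    ext a
    simp [hA]
  have hli1 (i : Fin 7) : LinearIndependent K ![p i] := by
    obtain ⟨j, hj⟩ : ∃ j : Fin 7, i ≠ j := ⟨i + 1, by decide +revert⟩
    have := (h.linearIndependent hK hj).ne_zero 0
    exact LinearIndependent.of_subsingleton 0 this
  have h0 : A.card + 1 = (q ^ 2) ^ 3 := by
    have h1 := herase (fun _ => True) trivial
    have h2 : _ = (q ^ 2) ^ 3 := natCard_dotProduct_eq_zero (F := F) (K := K) hK (linearIndependent_empty_type
      (v := (Fin.elim0 : Fin 0 → Fin 3 → K)))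
    rw [Finset.filter_true] at h1
    rw [h1, ← h2]
    exact Nat.card_congr (Equiv.subtypeEquivRight fun a => by simp)
  have h1 (i : Fin 7) : (A.filter fun a => a ⬝ᵥ p i = 0).card + 1 = (q ^ 2) ^ 2 := by
    rw [herase _ (by simp)]
    have h2 : _ = (q ^ 2) ^ 2 := natCard_dotProduct_eq_zero (F := F) hK (hli1 i)
    rw [← h2]
    exact Nat.card_congr (Equiv.subtypeEquivRight fun a => by simp)
  have h2 (i j : Fin 7) (hij : i ≠ j) :
      (A.filter fun a => a ⬝ᵥ p i = 0 ∧ a ⬝ᵥ p j = 0).card + 1 = q ^ 2 := by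
    rw [herase _ (by simp)]
    have h2 := natCard_dotProduct_eq_zero (F := F) hK (h.linearIndependent hK hij)
    rw [pow_one] at h2
    rw [hq, ← h2]
    exact Nat.card_congr (Equiv.subtypeEquivRight fun a => by simp [Fin.forall_fin_two])
  have s1 : ∑ a ∈ A, zeroCount p a = ∑ i : Fin 7, (A.filter fun a => a ⬝ᵥ p i = 0).card := by
    simp only [zeroCount, Finset.card_filter]
    rw [Finset.sum_comm]
    congr!
  -- The second factorial moment, counting ordered pairs of distinct points on the line of `a`. As
  -- at most two zeros occur, the moments of order 0, 1, 2 determine `N 0`, `N 1`, `N 2`.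
  have s2 : ∑ a ∈ A, (zeroCount p a * zeroCount p a - zeroCount p a) =
      ∑ x ∈ (Finset.univ : Finset (Fin 7)).offDiag,
        (A.filter fun a => a ⬝ᵥ p x.1 = 0 ∧ a ⬝ᵥ p x.2 = 0).card := by
    simp only [Finset.card_filter]
    rw [Finset.sum_comm]
    refine Finset.sum_congr rfl fun a _ => ?_
    rw [zeroCount, ← Finset.offDiag_card, ← Finset.card_filter]
    congr 1
    ext x
    simp
    tauto
  have c0 : A.card = N 0 + N 1 + N 2 := by
    simp only [hN, Finset.card_filter (p := fun a => zeroCount p a = _), ← Finset.sum_add_distrib]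
    rw [Finset.card_eq_sum_ones]
    refine Finset.sum_congr rfl fun a ha => ?_
    have := hle a ha
    interval_cases zeroCount p a <;> rfl
  have c1 : ∑ a ∈ A, zeroCount p a = N 1 + 2 * N 2 := by
    simp only [hN, Finset.card_filter (p := fun a => zeroCount p a = _), Finset.mul_sum,
      ← Finset.sum_add_distrib]
    refine Finset.sum_congr rfl fun a ha => ?_
    have := hle a ha
    interval_cases zeroCount p a <;> rfl
  have c2 : ∑ a ∈ A, (zeroCount p a * zeroCount p a - zeroCount p a) = 2 * N 2 := by
    simp only [hN, Finset.card_filter (p := fun a => zeroCount p a = _), Finset.mul_sum]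
    refine Finset.sum_congr rfl fun a ha => ?_
    have := hle a ha
    interval_cases zeroCount p a <;> rfl
  have t1 : ∑ i : Fin 7, (A.filter fun a => a ⬝ᵥ p i = 0).card + 7 = 7 * (q ^ 2) ^ 2 := by
    have : ∑ i : Fin 7, ((A.filter fun a => a ⬝ᵥ p i = 0).card + 1) = 7 * (q ^ 2) ^ 2 := by
      simp only [h1, Finset.sum_const, Finset.card_univ, Fintype.card_fin, smul_eq_mul]
    rw [← this, Finset.sum_add_distrib]
    simp
  have t2 : ∑ x ∈ (Finset.univ : Finset (Fin 7)).offDiag,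
      (A.filter fun a => a ⬝ᵥ p x.1 = 0 ∧ a ⬝ᵥ p x.2 = 0).card + 42 = 42 * q ^ 2 := by
    have hc : (Finset.univ : Finset (Fin 7)).offDiag.card = 42 := by
      rw [Finset.offDiag_card]; simp
    have : ∑ x ∈ (Finset.univ : Finset (Fin 7)).offDiag,
        ((A.filter fun a => a ⬝ᵥ p x.1 = 0 ∧ a ⬝ᵥ p x.2 = 0).card + 1) = 42 * q ^ 2 := by
      rw [Finset.sum_congr rfl fun x hx => h2 x.1 x.2 (by simpa using hx)]
      rw [Finset.sum_const, hc, smul_eq_mul]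
    rw [← this, Finset.sum_add_distrib, Finset.sum_const, hc]
    simp
  rw [← s1, c1] at t1
  rw [← s2, c2] at t2
  rw [c0] at h0
  zify at t1 t2 h0
  have t3 : (N 2 : ℤ) + 21 = 21 * (q : ℤ) ^ 2 := by linarith
  refine ⟨by linear_combination t3, ?_, ?_⟩
  · linear_combination t1 - 2 * t3
  · linear_combination h0 - t1 + t3

end Counting

/-! ### Minimality, reducedness and weight distribution -/

section Minimality

variable {F K : Type*} [Field F] [Field K] [Algebra F K] {ι : Type*}

/-- The functionals `k ↦ g (k * w)` and `k ↦ g (k * w')` have nested kernels, so the second is a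
multiple of the first; non-degeneracy transfers this to `w` and `w'`. -/
theorem exists_eq_smul_of_forall_mul {g : K →ₗ[F] F} (hg : g ≠ 0) {w w' : K}
    (h : ∀ k, g (k * w) = 0 → g (k * w') = 0) : ∃ t : F, w' = t • w := by
  let φ (w : K) : K →ₗ[F] F := g ∘ₗ LinearMap.mulRight F w
  have h1 : φ w' ∈ Submodule.span F (Set.range fun _ : Unit => φ w) := by
    refine mem_span_of_iInf_ker_le_ker (L := fun _ : Unit => φ w) fun k hk => ?_
    rw [iInf_const] at hk
    exact h k hk
  rw [Set.range_const] at h1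
  obtain ⟨t, ht⟩ := Submodule.mem_span_singleton.1 h1
  refine ⟨t, sub_eq_zero.1 (eq_zero_of_forall_mul hg fun k => ?_)⟩
  have h2 : t * g (k * w) = g (k * w') := LinearMap.congr_fun ht k
  rw [mul_sub, map_sub, mul_smul_comm, map_smul, smul_eq_mul, h2, sub_self]

/-- If `b` is a `K`-multiple of `a`, evaluation where `a ≠ 0` shows that the factor is in `F`;
otherwise `a, b` define a cone through all points. -/
theorem NoCone.exists_eq_smul {p : ι → Fin 3 → K} (h : NoCone F p) {a b : Fin 3 → K} (ha : a ≠ 0)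
    (hab : ∀ i, ∃ t : F, b ⬝ᵥ p i = t • (a ⬝ᵥ p i)) : ∃ s : F, b = s • a := by
  by_cases hl : ∃ l : K, b = l • a
  · obtain ⟨l, rfl⟩ := hl
    obtain ⟨i, hi⟩ := h.exists_dotProduct_ne_zero ha
    obtain ⟨t, ht⟩ := hab i
    rw [smul_dotProduct, smul_eq_mul, Algebra.smul_def] at ht
    exact ⟨t, by rw [mul_right_cancel₀ hi ht, algebraMap_smul]⟩
  · push Not at hl
    refine absurd (fun i => ?_) (h a b (linearIndependent_pair_of_ne_smul ha hl))
    obtain ⟨t, ht⟩ := hab i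
    exact ⟨t, 1, by simp, by rw [ht, one_smul]⟩

variable {m : ℕ} {p : Fin m → Fin 3 → K} {v : ι → Fin 3 → K} {e : ι × Fˣ ≃ Fin m × Kˣ}
  {g : K →ₗ[F] F}

theorem IsCoordinates.forall_mul (he : IsCoordinates F p v e) {a b : Fin 3 → K}
    (i : Fin m) (h : ∀ j c, (e (j, c)).1 = i → g (a ⬝ᵥ v j) = 0 → g (b ⬝ᵥ v j) = 0) (k : K)
    (hk : g (k * (a ⬝ᵥ p i)) = 0) : g (k * (b ⬝ᵥ p i)) = 0 := by
  by_cases hk0 : k = 0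
  · simp [hk0]
  obtain ⟨⟨j, c⟩, hj⟩ := e.surjective (i, Units.mk0 k hk0)
  have h1 := he (j, c)
  rw [hj] at h1
  simp only [Units.val_mk0] at h1
  have h2 (x : Fin 3 → K) : g (k * (x ⬝ᵥ p i)) = c * g (x ⬝ᵥ v j) := by
    rw [← smul_eq_mul, ← dotProduct_smul, ← h1, dotProduct_smul, map_smul, smul_eq_mul]
  rw [h2] at hk ⊢
  rw [h j c (by rw [hj]) (by simpa using hk), mul_zero]

theorem isMinimalCode_word (hg : g ≠ 0) (h : NoCone F p) (he : IsCoordinates F p v e) :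
    IsMinimalCode (LinearMap.range (word g v)) := by
  rintro _ ⟨a, rfl⟩ ha
  refine ⟨⟨a, rfl⟩, ha, ?_⟩
  rintro _ ⟨b, rfl⟩ hs
  have ha0 : a ≠ 0 := by rintro rfl; simp at ha
  obtain ⟨s, rfl⟩ := h.exists_eq_smul ha0 (b := b) fun i =>
    exists_eq_smul_of_forall_mul hg (he.forall_mul i fun j _ _ hj => by
      by_contra hb
      exact hs hb hj)
  exact ⟨s, map_smul _ _ _⟩

/-- A functional that does not vanish on the line `φ⟨p i⟩` vanishes on at most one point of it. -/
theorem IsCoordinates.eq_of_eq_zero (hK : Module.finrank F K = 2) (hg : g ≠ 0)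
    (he : IsCoordinates F p v e) (hv : ∀ j j' (s : F), v j' = s • v j → j = j')
    {a : Fin 3 → K} {i : Fin m} (ha : a ⬝ᵥ p i ≠ 0) {j j' : ι}
    {c c' : Fˣ} (hj : (e (j, c)).1 = i) (hj' : (e (j', c')).1 = i) (h : g (a ⬝ᵥ v j) = 0)
    (h' : g (a ⬝ᵥ v j') = 0) : j = j' := by
  have hfin : FiniteDimensional F K := Module.finite_of_finrank_pos (by omega)
  have key (j : ι) (c : Fˣ) (hj : (e (j, c)).1 = i) (h : g (a ⬝ᵥ v j) = 0) :
      g (((e (j, c)).2 : K) * (a ⬝ᵥ p i)) = 0 := by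
    have h1 := he (j, c)
    rw [hj] at h1
    rw [← smul_eq_mul, ← dotProduct_smul, ← h1, dotProduct_smul, map_smul, h, smul_zero]
  have h1 := key j c hj h
  have h2 := key j' c' hj' h'
  have h4 := g.finrank_range_add_finrank_ker
  rw [LinearMap.range_eq_top.2 (LinearMap.surjective hg), finrank_top, Module.finrank_self,
    hK] at h4
  -- The kernel of `g` is one-dimensional over `F`, so two zeros on the same line differ by a factor
  -- in `F` and are the same point.
  obtain ⟨z, hz⟩ := finrank_eq_one_iff'.1 (show Module.finrank F (LinearMap.ker g) = 1 by omega)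
  obtain ⟨s, hs⟩ := hz.2 ⟨_, h1⟩
  obtain ⟨s', hs'⟩ := hz.2 ⟨_, h2⟩
  have hs1 : s • (z : K) = ((e (j, c)).2 : K) * (a ⬝ᵥ p i) := congrArg Subtype.val hs
  have hs2 : s' • (z : K) = ((e (j', c')).2 : K) * (a ⬝ᵥ p i) := congrArg Subtype.val hs'
  have hs0 : s ≠ 0 := by
    rintro rfl
    rw [zero_smul] at hs1
    exact mul_ne_zero (Units.ne_zero _) ha hs1.symm
  have hs0' : s' ≠ 0 := by
    rintro rfl
    rw [zero_smul] at hs2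
    exact mul_ne_zero (Units.ne_zero _) ha hs2.symm
  have h5 : (((e (j', c')).2 : K)) = (s' / s) • ((e (j, c)).2 : K) := by
    refine mul_right_cancel₀ ha ?_
    rw [smul_mul_assoc, ← hs1, ← hs2, smul_smul, div_mul_cancel₀ _ hs0]
  have h6 : (c' : F) • v j' = ((s' / s) * c) • v j := by
    rw [mul_smul, he (j, c), he (j', c'), hj, hj', h5, smul_assoc]
  refine hv j j' ((c' : F)⁻¹ * ((s' / s) * c)) ?_
  rw [mul_smul, ← h6, smul_smul, inv_mul_cancel₀ c'.ne_zero, one_smul]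

/-- A reducing pair for the line of the deleted point gives words of `a` and `b` whose zeros are
nested on the other six lines. Scaling the pair by an element of `K` moves the only zero of `a` on
the remaining line to the deleted point, so nesting holds after deletion, yet the words stay
non-proportional. -/
theorem not_isMinimalCode_puncture [Finite F] [Fintype ι] {p : Fin 7 → Fin 3 → K}
    {e : ι × Fˣ ≃ Fin 7 × Kˣ}
    (hK : Module.finrank F K = 2) (hg : g ≠ 0) (h : NoCone F p) (he : IsCoordinates F p v e)
    (hv : ∀ j j' (s : F), v j' = s • v j → j = j') (hr : ∀ i, HasReducingPair F p i) (j₀ : ι) :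
    ¬ IsMinimalCode (puncture (LinearMap.range (word g v)) j₀) := by
  classical
  intro hmin
  obtain ⟨a₀, b₀, hab₀, hprop₀⟩ := hr (e (j₀, 1)).1
  set i₀ := (e (j₀, 1)).1 with hi₀
  have ha₀ : a₀ ⬝ᵥ p i₀ ≠ 0 := fun h0 => h a₀ b₀ hab₀ fun i => by
    by_cases hi : i = i₀
    · exact ⟨1, 0, by simp, by simp [hi, h0]⟩
    · obtain ⟨t, ht⟩ := hprop₀ i hi
      exact ⟨t, 1, by simp, by rw [ht, one_smul]⟩
  -- A linear map from a space of dimension 2 to one of dimension 1 has a non-zero kernel vector.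
  obtain ⟨k, hk, hk0⟩ : ∃ k : K, g (k * (a₀ ⬝ᵥ v j₀)) = 0 ∧ k ≠ 0 := by
    have hfin : FiniteDimensional F K := Module.finite_of_finrank_pos (by omega)
    have h4 := (g ∘ₗ LinearMap.mulRight F (a₀ ⬝ᵥ v j₀)).finrank_range_add_finrank_ker
    have h5 := Submodule.finrank_le (LinearMap.range (g ∘ₗ LinearMap.mulRight F (a₀ ⬝ᵥ v j₀)))
    rw [Module.finrank_self] at h5
    rw [hK] at h4
    obtain ⟨z, hz, hz0⟩ := Submodule.exists_mem_ne_zero_of_ne_bot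
      (p := LinearMap.ker (g ∘ₗ LinearMap.mulRight F (a₀ ⬝ᵥ v j₀))) (by
        intro hb
        rw [hb, finrank_bot] at h4
        omega)
    exact ⟨z, hz, hz0⟩
  set a := k • a₀ with ha
  set b := k • b₀ with hb
  have hai : a ⬝ᵥ p i₀ ≠ 0 := by
    rw [ha, smul_dotProduct]
    exact mul_ne_zero hk0 ha₀
  have haj : g (a ⬝ᵥ v j₀) = 0 := by rw [ha, smul_dotProduct]; exact hk
  have hprop (i) (hi : i ≠ i₀) : ∃ t : F, b ⬝ᵥ p i = t • (a ⬝ᵥ p i) := by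
    obtain ⟨t, ht⟩ := hprop₀ i hi
    refine ⟨t, ?_⟩
    rw [hb, ha, smul_dotProduct, smul_dotProduct, ht, smul_comm]
  have hne (t : F) : b ≠ t • a := fun hbt => by
    have := LinearIndependent.pair_iff.1 hab₀ (algebraMap F K t) (-1) (by
      have h1 : k • b₀ = k • (algebraMap F K t • a₀) := by
        rw [← hb, hbt, ha, algebraMap_smul, smul_comm]
      rw [← smul_right_injective _ hk0 h1]
      simp)
    simpa using this.2
  have hzero (j) (hj : j ≠ j₀) (h0 : g (a ⬝ᵥ v j) = 0) : g (b ⬝ᵥ v j) = 0 := by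
    have hi : (e (j, 1)).1 ≠ i₀ := fun hi =>
      hj (he.eq_of_eq_zero hK hg hv hai hi hi₀.symm h0 haj)
    obtain ⟨t, ht⟩ := hprop _ hi
    have h1 := he (j, 1)
    rw [Units.val_one, one_smul] at h1
    rw [h1, dotProduct_smul, smul_eq_mul] at h0 ⊢
    rw [ht, mul_smul_comm, map_smul, h0, smul_zero]
  -- Non-zero words have weight at least `5q > 1`, so none is supported at `j₀` alone and puncturing
  -- is injective.
  have hweight (c : Fin 3 → K) (hc : c ≠ 0) : ∃ j ≠ j₀, word g v c j ≠ 0 := by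
    by_contra! hcon
    have h1 := he.hammingNorm_word hK hg c
    have h2 := h.card_filter_le hK hc
    have h3 := Finset.card_filter_add_card_filter_not (s := (Finset.univ : Finset (Fin 7)))
      (fun i => c ⬝ᵥ p i = 0)
    rw [Finset.card_univ, Fintype.card_fin] at h3
    have h4 : hammingNorm (word g v c) ≤ 1 := by
      unfold hammingNorm
      refine Finset.card_le_one.2 fun x hx y hy => ?_
      simp only [Finset.mem_filter, Finset.mem_univ, true_and] at hx hy
      rw [not_imp_comm.1 (hcon x) hx, not_imp_comm.1 (hcon y) hy]
    have h5 : 1 < Nat.card F := Finite.one_lt_card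
    have h6 : 5 ≤ (Finset.univ.filter fun i => ¬ c ⬝ᵥ p i = 0).card := by omega
    have h7 := Nat.mul_le_mul h5.le h6
    rw [h1] at h4
    exact absurd (h7.trans h4) (by norm_num)
  have ha0 : a ≠ 0 := by rintro h0; simp [h0] at hai
  let P := LinearMap.funLeft F F (Subtype.val : {j : ι // j ≠ j₀} → ι)
  obtain ⟨j₁, hj₁, hw₁⟩ := hweight a ha0
  obtain ⟨-, -, hm⟩ := hmin (P (word g v a)) ⟨_, ⟨a, rfl⟩, rfl⟩ fun h0 =>
    hw₁ (congrFun h0 ⟨j₁, hj₁⟩)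
  obtain ⟨t, ht⟩ := hm (P (word g v b)) ⟨_, ⟨b, rfl⟩, rfl⟩ fun j hj h0 => hj (hzero j j.2 h0)
  obtain ⟨j₂, hj₂, hw₂⟩ := hweight (b - t • a) (sub_ne_zero.2 (hne t))
  refine hw₂ ?_
  rw [map_sub, LinearMap.map_smul (word g v) t a]
  exact sub_eq_zero.2 (congrFun ht ⟨j₂, hj₂⟩)

theorem NoCone.isReducedMinimalCode_word [Finite F] [Fintype ι] {p : Fin 7 → Fin 3 → K}
    {e : ι × Fˣ ≃ Fin 7 × Kˣ}
    (hK : Module.finrank F K = 2) (hg : g ≠ 0) (h : NoCone F p) (he : IsCoordinates F p v e)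
    (hv : ∀ j j' (s : F), v j' = s • v j → j = j') (hr : ∀ i, HasReducingPair F p i) :
    IsReducedMinimalCode (LinearMap.range (word g v)) :=
  ⟨isMinimalCode_word hg h he, not_isMinimalCode_puncture hK hg h he hv hr⟩

section WeightDistribution

variable {r : Fin 7 → Fin 3 → K} {f : ι × Fˣ ≃ Fin 7 × Kˣ}

theorem hammingNorm_word_eq_sub [Finite F] [Fintype ι] [DecidableEq F] (hK : Module.finrank F K = 2) (hg : g ≠ 0)
    (he : IsCoordinates F r v f) (a : Fin 3 → K) :
    hammingNorm (word g v a) = (7 - zeroCount r a) * Nat.card F ∧ zeroCount r a ≤ 7 := by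
  classical
  have h3 := Finset.card_filter_add_card_filter_not (s := (Finset.univ : Finset (Fin 7)))
    (fun i => a ⬝ᵥ r i = 0)
  rw [Finset.card_univ, Fintype.card_fin] at h3
  have h4 : zeroCount r a = (Finset.univ.filter fun i => a ⬝ᵥ r i = 0).card := by
    unfold zeroCount
    congr!
  have h5 := he.hammingNorm_word hK hg a
  refine ⟨?_, by omega⟩
  rw [h5, mul_comm, h4]
  congr 1
  refine Nat.eq_sub_of_add_eq' ?_
  convert h3

theorem hammingNorm_word_eq_iff [Finite F] [Fintype ι] [DecidableEq F] (hK : Module.finrank F K = 2) (hg : g ≠ 0)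
    (he : IsCoordinates F r v f) {k : ℕ} (hk : k ≤ 2) (a : Fin 3 → K) :
    hammingNorm (word g v a) = (7 - k) * Nat.card F ↔ a ≠ 0 ∧ zeroCount r a = k := by
  obtain ⟨h1, h2⟩ := hammingNorm_word_eq_sub hK hg he a
  have hq : 0 < Nat.card F := Nat.card_pos
  rw [h1, Nat.mul_left_inj hq.ne']
  have h3 : a = 0 → zeroCount r a = 7 := by rintro rfl; simp [zeroCount]
  constructor
  · intro h4
    exact ⟨fun h0 => by have := h3 h0; omega, by omega⟩
  · rintro ⟨-, rfl⟩
    rfl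

theorem NoCone.word_injective (hg : g ≠ 0) (h : NoCone F r)
    (he : IsCoordinates F r v f) : Function.Injective (word g v) := by
  rw [injective_iff_map_eq_zero]
  intro a ha
  by_contra ha0
  obtain ⟨i, hi⟩ := h.exists_dotProduct_ne_zero ha0
  refine hi (eq_zero_of_forall_mul hg fun k => ?_)
  refine he.forall_mul (a := 0) i (fun j _ _ _ => congrFun ha j) k (by simp)

theorem NoCone.weightDistribution [Finite F] [Fintype ι] [DecidableEq F] (hK : Module.finrank F K = 2)
    (hF : 2 < Nat.card F) (hg : g ≠ 0) (h : NoCone F r) (he : IsCoordinates F r v f) :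
    nonzeroWeights (LinearMap.range (word g v)) =
      {5 * Nat.card F, 6 * Nat.card F, 7 * Nat.card F} ∧
    (weightCount (LinearMap.range (word g v)) (5 * Nat.card F) : ℤ) =
      21 * ((Nat.card F : ℤ) ^ 2 - 1) ∧
    (weightCount (LinearMap.range (word g v)) (6 * Nat.card F) : ℤ) =
      7 * ((Nat.card F : ℤ) ^ 2 - 5) * ((Nat.card F : ℤ) ^ 2 - 1) ∧
    (weightCount (LinearMap.range (word g v)) (7 * Nat.card F) : ℤ) =
      ((Nat.card F : ℤ) ^ 4 - 6 * (Nat.card F : ℤ) ^ 2 + 15) * ((Nat.card F : ℤ) ^ 2 - 1) := by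
  classical
  have hfin : FiniteDimensional F K := Module.finite_of_finrank_pos (by omega)
  have := Module.finite_of_finite F (M := K)
  have := Fintype.ofFinite K
  have hinj := h.word_injective hg he
  let N (k : ℕ) : ℕ :=
    ((Finset.univ.filter fun a : Fin 3 → K => a ≠ 0).filter fun a => zeroCount r a = k).card
  have hN (k : ℕ) (hk : k ≤ 2) :
      weightCount (LinearMap.range (word g v)) ((7 - k) * Nat.card F) = N k := by
    have h1 : {u : ι → F | u ∈ LinearMap.range (word g v) ∧
        hammingNorm u = (7 - k) * Nat.card F} = word g v ''
        (((Finset.univ.filter fun a : Fin 3 → K => a ≠ 0).filter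
          fun a => zeroCount r a = k : Finset (Fin 3 → K)) : Set (Fin 3 → K)) := by
      ext u
      constructor
      · rintro ⟨⟨a, rfl⟩, ha⟩
        refine ⟨a, ?_, rfl⟩
        simpa using (hammingNorm_word_eq_iff hK hg he hk a).1 ha
      · rintro ⟨a, ha, rfl⟩
        exact ⟨⟨a, rfl⟩, (hammingNorm_word_eq_iff hK hg he hk a).2 (by simpa using ha)⟩
    rw [weightCount, h1, Set.ncard_image_of_injective _ hinj, Set.ncard_coe_finset]
  obtain ⟨c2, c1, c0⟩ := card_zeroCount_eq hK h N fun _ => rfl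
  have hq : (3 : ℤ) ≤ Nat.card F := by exact_mod_cast hF
  have hq2 : (9 : ℤ) ≤ (Nat.card F : ℤ) ^ 2 := by nlinarith
  -- All three weights occur because `q ≥ 3`; note that `q⁴ - 6q² + 15 = (q² - 3)² + 6`.
  have hpos (k : ℕ) (hk : k ≤ 2) : N k ≠ 0 := by
    have : (0 : ℤ) < N k := by
      interval_cases k
      · rw [c0]
        have : (0 : ℤ) < (Nat.card F : ℤ) ^ 4 - 6 * (Nat.card F : ℤ) ^ 2 + 15 := by
          nlinarith [sq_nonneg ((Nat.card F : ℤ) ^ 2 - 3)]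
        exact mul_pos this (by linarith)
      · rw [c1]
        exact mul_pos (mul_pos (by norm_num) (by linarith)) (by linarith)
      · rw [c2]
        linarith
    omega
  refine ⟨?_, ?_, ?_, ?_⟩
  · ext w
    have hw : w ∈ ({5 * Nat.card F, 6 * Nat.card F, 7 * Nat.card F} : Set ℕ) ↔
        ∃ k ≤ 2, w = (7 - k) * Nat.card F := by
      simp only [Set.mem_insert_iff, Set.mem_singleton_iff]
      constructor
      · rintro (rfl | rfl | rfl)
        exacts [⟨2, by norm_num⟩, ⟨1, by norm_num⟩, ⟨0, by norm_num⟩]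
      · rintro ⟨k, hk, rfl⟩
        interval_cases k <;> simp
    rw [hw]
    constructor
    · rintro ⟨_, ⟨a, rfl⟩, ha, rfl⟩
      have ha0 : a ≠ 0 := by rintro rfl; simp at ha
      refine ⟨zeroCount r a, ?_, (hammingNorm_word_eq_sub hK hg he a).1⟩
      have := h.card_filter_le hK ha0
      unfold zeroCount
      convert this
    · rintro ⟨k, hk, rfl⟩
      obtain ⟨a, ha⟩ := Finset.card_ne_zero.1 (hpos k hk)
      have ha' : a ≠ 0 ∧ zeroCount r a = k := by simpa using ha
      exact ⟨_, ⟨a, rfl⟩, fun h0 => ha'.1 (hinj (by rw [h0, map_zero])),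
        (hammingNorm_word_eq_iff hK hg he hk a).2 ha'⟩
  · rw [← c2, ← hN 2 le_rfl]
  · rw [← c1, ← hN 1 (by norm_num)]
  · rw [← c0, ← hN 0 (by norm_num)]

end WeightDistribution

theorem givesSevenLinesCode_range [Finite F] [DecidableEq F] {p : Fin 7 → Fin 3 → K}
    (hK : Module.finrank F K = 2) (hF : 2 < Nat.card F) (hp : ∀ i, p i ≠ 0)
    (h : NoCone F p) (hr : ∀ i, HasReducingPair F p i) :
    GivesSevenLinesCode F (Set.range fun i => Projectivization.mk K (p i) (hp i)) := by
  have hfin : FiniteDimensional F K := Module.finite_of_finrank_pos (by omega)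
  have := Module.finite_of_finite F (M := K)
  have hinj : Function.Injective fun i => Projectivization.mk K (p i) (hp i) := by
    intro i j hij
    by_contra hne
    obtain ⟨s, hs⟩ := (Projectivization.mk_eq_mk_iff' K _ _ _ _).1 hij
    have := LinearIndependent.pair_iff.1 (h.linearIndependent hK hne) 1 (-s) (by simp [← hs])
    simp at this
  constructor
  -- For the size of `B`, its own points, with chosen representatives, serve as columns.
  · set B := linePoints F (Set.range fun i => Projectivization.mk K (p i) (hp i))
    obtain ⟨e, -⟩ := exists_isCoordinates (F := F) (ι := B) hp hinj
      (v := fun R => R.1.rep) (fun R => R.1.rep_nonzero) (by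
        simp only [Projectivization.mk_rep]
        exact ⟨fun R _ => R.2, Subtype.val_injective.injOn, fun R hR => ⟨⟨R, hR⟩, trivial, rfl⟩⟩)
    exact natCard_of_equiv_prod_units hK e
  intro C hC
  obtain ⟨g, hg⟩ := exists_ne (0 : K →ₗ[F] F)
  obtain ⟨v, hv, hb, rfl⟩ := hC.exists_eq_range hg
  obtain ⟨e, he⟩ := exists_isCoordinates hp hinj hv hb
  refine ⟨?_, h.isReducedMinimalCode_word hK hg he (fun j j' s hs => ?_) hr,
    h.weightDistribution hK hF hg he⟩
  · rw [LinearMap.finrank_range_of_inj (h.word_injective hg he), Module.finrank_pi_fintype]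
    simp [hK]
  · exact (hb.injOn (Set.mem_univ j') (Set.mem_univ j)
      ((Projectivization.mk_eq_mk_iff' F _ _ _ _).2 ⟨s, hs.symm⟩)).symm

end Minimality

/-! ### Cyclically symmetric sets, conjugation and concurrent lines -/

section CyclicSets

variable {F K : Type*} [Field F] [Field K] [Algebra F K]

/-- The vectors `e₁, e₂, e₃, (1,1,1)` and the cyclic shifts of `(1,y,z)`. -/
def cyclicPoints (y z : K) : Fin 7 → Fin 3 → K :=
  ![![1, 0, 0], ![0, 1, 0], ![0, 0, 1], ![1, 1, 1], ![1, y, z], ![z, 1, y], ![y, z, 1]]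

theorem cyclicPoints_ne_zero (y z : K) (i : Fin 7) : cyclicPoints y z i ≠ 0 := by
  intro h
  have h0 := congrFun h 0
  have h1 := congrFun h 1
  have h2 := congrFun h 2
  fin_cases i <;> simp [cyclicPoints] at h0 h1 h2

theorem pointSet_eq_range (x : F) (ξ : K) :
    pointSet x ξ = Set.range fun i => Projectivization.mk K
      (cyclicPoints (algebraMap F K x) (ξ * algebraMap F K x) i) (cyclicPoints_ne_zero _ _ i) := by
  have h (v : Fin 3 → K) (hv : v ≠ 0) (P : ℙ K (Fin 3 → K)) :
      P.submodule = Submodule.span K {v} ↔ P = Projectivization.mk K v hv := by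
    rw [← Projectivization.submodule_mk v hv, Projectivization.submodule_injective.eq_iff]
  have h7 : ({![1, 0, 0], ![0, 1, 0], ![0, 0, 1], ![1, 1, 1],
      ![1, algebraMap F K x, ξ * algebraMap F K x], ![ξ * algebraMap F K x, 1, algebraMap F K x],
      ![algebraMap F K x, ξ * algebraMap F K x, 1]} : Set (Fin 3 → K)) =
      Set.range (cyclicPoints (algebraMap F K x) (ξ * algebraMap F K x)) := by
    simp only [cyclicPoints, Matrix.range_cons, Matrix.range_empty, Set.union_empty,
      Set.singleton_union]
  ext P
  simp only [pointSet, h7, Set.mem_range, Set.mem_ofPred_eq, exists_exists_eq_and]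
  exact exists_congr fun i => (h _ _ _).trans eq_comm

theorem NoCone.isSevenSet {p : Fin 7 → Fin 3 → K} (hK : Module.finrank F K = 2) (h : NoCone F p)
    (hp : ∀ i, p i ≠ 0) : IsSevenSet F (Set.range fun i => Projectivization.mk K (p i) (hp i)) := by
  refine ⟨?_, fun H hH => h.not_subset hp hH⟩
  have hinj : Function.Injective fun i => Projectivization.mk K (p i) (hp i) := by
    intro i j hij
    by_contra hne
    obtain ⟨s, hs⟩ := (Projectivization.mk_eq_mk_iff' K _ _ _ _).1 hij
    have := LinearIndependent.pair_iff.1 (h.linearIndependent hK hne) 1 (-s) (by simp [← hs])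
    simp at this
  rw [← Set.image_univ, Set.ncard_image_of_injective _ hinj, Set.ncard_univ, Nat.card_fin]

theorem IsSevenSet.noCone {p : Fin 7 → Fin 3 → K} (hp : ∀ i, p i ≠ 0)
    (h : IsSevenSet F (Set.range fun i => Projectivization.mk K (p i) (hp i))) : NoCone F p :=
  noCone_of_not_subset hp h.2

/-- A cone over a Baer subline is given by a pair of functionals on which a skew-Hermitian form
without diagonal terms and with determinant zero vanishes. -/
theorem noCone_cyclicPoints (σ : K →ₐ[F] K) (hσ : ∀ z, σ (σ z) = z) {y z : K}
    (H : ∀ α β γ : K, σ (α + β + γ) = α + β + γ →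
      σ (γ * σ y + α * (y * σ z) + β * z) = γ * σ y + α * (y * σ z) + β * z →
      σ (γ * z + α * σ y + β * (y * σ z)) = γ * z + α * σ y + β * (y * σ z) →
      σ (γ * (y * σ z) + α * z + β * σ y) = γ * (y * σ z) + α * z + β * σ y →
      σ (α * β * γ) = α * β * γ → α = 0 ∧ β = 0 ∧ γ = 0) :
    NoCone F (cyclicPoints y z) := by
  intro a b hab hcone
  -- An `F`-rational ratio is fixed by `σ`. This says that the skew-Hermitian matrix `M i j = a i *
  -- σ (b j) - σ (a j) * b i` vanishes at the seven points.
  have key (i : Fin 7) : (a ⬝ᵥ cyclicPoints y z i) * σ (b ⬝ᵥ cyclicPoints y z i) =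
      σ (a ⬝ᵥ cyclicPoints y z i) * (b ⬝ᵥ cyclicPoints y z i) := by
    obtain ⟨s, t, hst, he⟩ := hcone i
    have he' := congrArg σ he
    rw [map_smul, map_smul] at he'
    rw [Algebra.smul_def, Algebra.smul_def] at he he'
    by_cases hs : s = 0
    · have ht : algebraMap F K t ≠ 0 := by simpa using (show t ≠ 0 by tauto)
      refine mul_left_cancel₀ ht ?_
      linear_combination (a ⬝ᵥ cyclicPoints y z i) * (-he') +
        σ (a ⬝ᵥ cyclicPoints y z i) * he
    · have hs' : algebraMap F K s ≠ 0 := by simpa using hs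
      refine mul_left_cancel₀ hs' ?_
      linear_combination σ (b ⬝ᵥ cyclicPoints y z i) * he - (b ⬝ᵥ cyclicPoints y z i) * he'
  have k0 := key 0; have k1 := key 1; have k2 := key 2; have k3 := key 3
  have k4 := key 4; have k5 := key 5; have k6 := key 6
  simp [cyclicPoints, dotProduct, Fin.sum_univ_three] at k0 k1 k2 k3 k4 k5 k6
  -- These are `M 1 2`, `M 2 0`, `M 0 1`. The diagonal is zero by the three unit vectors, so `det M
  -- = αβγ - σ (αβγ)`, which is zero because `M` is a sum of two matrices of rank at most one.
  obtain ⟨hα, hβ, hγ⟩ := H (a 1 * σ (b 2) - σ (a 2) * b 1) (a 2 * σ (b 0) - σ (a 0) * b 2)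
    (a 0 * σ (b 1) - σ (a 1) * b 0)
    (by simp only [map_add, map_sub, map_mul, hσ]; linear_combination -k3 + k0 + k1 + k2)
    (by
      simp only [map_add, map_sub, map_mul, hσ]
      linear_combination -k4 + k0 + (y * σ y) * k1 + (z * σ z) * k2)
    (by
      simp only [map_add, map_sub, map_mul, hσ]
      linear_combination -k5 + (z * σ z) * k0 + k1 + (y * σ y) * k2)
    (by
      simp only [map_add, map_sub, map_mul, hσ]
      linear_combination -k6 + (y * σ y) * k0 + (z * σ z) * k1 + k2)
    (by
      simp only [map_sub, map_mul, hσ]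
      linear_combination
        (a 1 * σ (b 1) - σ (a 1) * b 1) * (a 2 * σ (b 2) - σ (a 2) * b 2) * k0
        - (a 0 * σ (b 1) - σ (a 1) * b 0) * (a 1 * σ (b 0) - σ (a 0) * b 1) * k2
        - (a 0 * σ (b 2) - σ (a 2) * b 0) * (a 2 * σ (b 0) - σ (a 0) * b 2) * k1
        - (a 1 * σ (b 2) - σ (a 2) * b 1) * (a 2 * σ (b 1) - σ (a 1) * b 2) * k0)
  have hα' := congrArg σ hα; have hβ' := congrArg σ hβ; have hγ' := congrArg σ hγ
  simp only [map_sub, map_mul, map_zero, hσ] at hα' hβ' hγ'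
  -- Now `M = 0`, which forces `b` to be proportional to `a`.
  have hall (i j : Fin 3) : a i * σ (b j) = σ (a j) * b i := by
    fin_cases i <;> fin_cases j <;> simp only [Fin.zero_eta, Fin.mk_one, Fin.reduceFinMk] <;>
      first
        | assumption
        | linear_combination hα
        | linear_combination hβ
        | linear_combination hγ
        | linear_combination -hα'
        | linear_combination -hβ'
        | linear_combination -hγ'
  have ha : a ≠ 0 := hab.ne_zero 0
  obtain ⟨i, hi⟩ := Function.ne_iff.1 ha
  have hi' : a i ≠ 0 := hi
  refine (LinearIndependent.pair_iff' ha).1 hab (σ (b i / a i)) (funext fun j => ?_)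
  have h1 : σ (b j) = b i / a i * σ (a j) := by
    have := hall i j
    field_simp
    linear_combination this
  have h2 := congrArg σ h1
  rw [hσ, map_mul, hσ] at h2
  exact h2.symm

/-- The non-trivial automorphism of the quadratic Galois extension; subtracting the equations of `ξ`
and `σ ξ` and cancelling `σ ξ - ξ` gives the trace. -/
theorem exists_conj [Finite F] (hK : Module.finrank F K = 2) :
    ∃ σ : K →ₐ[F] K, (∀ z, σ (σ z) = z) ∧
      ∀ (ξ : K) (τ n : F), ξ ∉ Set.range (algebraMap F K) →
        ξ ^ 2 = algebraMap F K τ * ξ - algebraMap F K n →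
        σ ξ = algebraMap F K τ - ξ ∧ σ ξ ≠ ξ := by
  have hfin : FiniteDimensional F K := Module.finite_of_finrank_pos (by omega)
  have := Module.finite_of_finite F (M := K)
  have hc : Nat.card (K ≃ₐ[F] K) = 2 := by rw [IsGalois.card_aut_eq_finrank, hK]
  obtain ⟨σ, hσ1, hσ⟩ := (Nat.card_eq_two_iff' (1 : K ≃ₐ[F] K)).1 hc
  refine ⟨σ, fun z => ?_, fun ξ τ n hξ h => ?_⟩
  · have : σ * σ = 1 := by
      by_contra hne
      exact hσ1 (by simpa using hσ _ hne)
    exact DFunLike.congr_fun this z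
  · have h1 : σ ξ ≠ ξ := fun h1 => hξ ((IsGalois.mem_range_algebraMap_iff_fixed ξ).2 fun f => by
      by_cases hf : f = 1
      · rw [hf]; rfl
      · rw [hσ f hf]; exact h1)
    have h2 := congrArg σ h
    rw [map_sub, map_mul, map_pow, AlgEquiv.commutes, AlgEquiv.commutes] at h2
    refine ⟨mul_left_cancel₀ (sub_ne_zero.2 h1) ?_, h1⟩
    change (σ ξ - ξ) * σ ξ = _
    linear_combination h2 - h

theorem exists_eq_add_mul (hK : Module.finrank F K = 2) {ξ : K}
    (hξ : ξ ∉ Set.range (algebraMap F K)) (z : K) :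
    ∃ A B : F, z = algebraMap F K A + algebraMap F K B * ξ := by
  have hfin : FiniteDimensional F K := Module.finite_of_finrank_pos (by omega)
  have hl : LinearIndependent F ![(1 : K), ξ] := (LinearIndependent.pair_iff' one_ne_zero).2
    fun s hs => hξ ⟨s, by rw [← hs, Algebra.smul_def, mul_one]⟩
  have hs := hl.span_eq_top_of_card_eq_finrank (by simp [hK])
  have hz : z ∈ Submodule.span F (Set.range ![(1 : K), ξ]) := hs ▸ Submodule.mem_top
  rw [Matrix.range_cons, Matrix.range_cons, Matrix.range_empty, Set.union_empty,
    Set.singleton_union, Submodule.mem_span_pair] at hz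
  obtain ⟨A, B, h⟩ := hz
  exact ⟨A, B, by rw [← h, Algebra.smul_def, Algebra.smul_def, mul_one]⟩

/-- Three concurrent lines with equations `l₁ = 0`, `l₂ = 0`, `l₁ + l₂ = 0` through all points but
one give a reducing pair if the ground field has more than two elements. -/
theorem hasReducingPair_of_concurrent (hF : 2 < Nat.card F) {ι : Type*} {p : ι → Fin 3 → K}
    {i₀ : ι} {l₁ l₂ : Fin 3 → K} (hl : LinearIndependent K ![l₁, l₂])
    (h : ∀ i ≠ i₀, l₁ ⬝ᵥ p i = 0 ∨ l₂ ⬝ᵥ p i = 0 ∨ (l₁ + l₂) ⬝ᵥ p i = 0) :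
    HasReducingPair F p i₀ := by
  have : Finite F := Nat.finite_of_card_ne_zero (by omega)
  have := Fintype.ofFinite F
  classical
  obtain ⟨k, -, hk⟩ := Finset.exists_mem_notMem_of_card_lt_card
    (s := ({0, 1} : Finset F)) (t := Finset.univ) (by
      rw [Finset.card_univ, ← Nat.card_eq_fintype_card]
      exact lt_of_le_of_lt Finset.card_le_two hF)
  simp only [Finset.mem_insert, Finset.mem_singleton, not_or] at hk
  have hk0 : algebraMap F K k ≠ 0 := by simpa using hk.1
  have hk1 : 1 - k ≠ 0 := sub_ne_zero.2 (Ne.symm hk.2)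
  -- The quotient is `0`, `1`, `(1 - k)⁻¹` on the three lines respectively.
  refine ⟨l₁ + algebraMap F K k • l₂, l₁, ?_, fun i hi => ?_⟩
  · rw [LinearIndependent.pair_iff] at hl ⊢
    intro s t hst
    have := hl (s + t) (s * algebraMap F K k) (by rw [← hst]; module)
    have hs : s = 0 := by simpa [hk0] using this.2
    exact ⟨hs, by simpa [hs] using this.1⟩
  · rcases h i hi with h1 | h1 | h1
    · exact ⟨0, by simp [h1]⟩
    · exact ⟨1, by simp [add_dotProduct, h1]⟩
    · refine ⟨(1 - k)⁻¹, ?_⟩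
      rw [add_dotProduct] at h1
      have h2 : (l₁ + algebraMap F K k • l₂) ⬝ᵥ p i = algebraMap F K (1 - k) * (l₁ ⬝ᵥ p i) := by
        rw [add_dotProduct, smul_dotProduct, smul_eq_mul, map_sub, map_one]
        linear_combination algebraMap F K k * h1
      rw [h2, Algebra.smul_def, ← mul_assoc, ← map_mul, inv_mul_cancel₀ hk1, map_one, one_mul]

/-- Rotating the coordinates permutes the seven points with orbits `{0,1,2}`, `{3}`, `{4,5,6}`, so
one index from each orbit suffices. -/
theorem HasReducingPair.shift {y z : K} {i j : Fin 7} (π : Equiv.Perm (Fin 7))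
    (hπ : π = Equiv.swap 0 1 * Equiv.swap 1 2 * (Equiv.swap 4 5 * Equiv.swap 5 6)) (hj : j = π i)
    (h : HasReducingPair F (cyclicPoints y z) i) : HasReducingPair F (cyclicPoints y z) j := by
  obtain ⟨a, b, hab, hp⟩ := h
  have hdot (a : Fin 3 → K) (i : Fin 7) :
      ![a 2, a 0, a 1] ⬝ᵥ cyclicPoints y z (π i) = a ⬝ᵥ cyclicPoints y z i := by
    have h7 : π i = (![1, 2, 0, 3, 5, 6, 4] : Fin 7 → Fin 7) i := by subst hπ; decide +revert
    rw [h7]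
    fin_cases i <;> simp [cyclicPoints, dotProduct, Fin.sum_univ_three] <;> ring
  refine ⟨![a 2, a 0, a 1], ![b 2, b 0, b 1], ?_, fun k hk => ?_⟩
  · rw [LinearIndependent.pair_iff] at hab ⊢
    intro s t hst
    refine hab s t ?_
    have h0 := congrFun hst 0
    have h1 := congrFun hst 1
    have h2 := congrFun hst 2
    simp at h0 h1 h2
    funext m
    fin_cases m <;> simpa
  · obtain ⟨k, rfl⟩ := π.surjective k
    rw [hdot, hdot]
    exact hp k fun hki => hk (by rw [hj, hki])

theorem hasReducingPair_cyclicPoints {y z : K} (h0 : HasReducingPair F (cyclicPoints y z) 0)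
    (h3 : HasReducingPair F (cyclicPoints y z) 3) (h4 : HasReducingPair F (cyclicPoints y z) 4)
    (i : Fin 7) : HasReducingPair F (cyclicPoints y z) i := by
  have h1 := h0.shift (j := 1) _ rfl (by decide)
  have h2 := h1.shift (j := 2) _ rfl (by decide)
  have h5 := h4.shift (j := 5) _ rfl (by decide)
  have h6 := h5.shift (j := 6) _ rfl (by decide)
  fin_cases i <;> assumption

end CyclicSets

/-! ### Explicit pairs of functionals for small fields -/

section Specific

variable {F K : Type*} [Field F] [Field K] [Algebra F K]

/-- Since `x³ = 1`, the two functionals, with common zero `(1, x, x²)`, have values in an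
`F`-rational ratio at all seven points. -/
theorem not_noCone_of_root {x : F} (hx : x ^ 2 + x + 1 = 0) (ξ : K) :
    ¬ NoCone F (cyclicPoints (algebraMap F K x) (ξ * algebraMap F K x)) := by
  intro h
  have hx0 : x ≠ 0 := by rintro rfl; simp at hx
  have hX : algebraMap F K x ^ 2 + algebraMap F K x + 1 = 0 := by
    rw [← map_pow, ← map_add, ← map_one (algebraMap F K), ← map_add, hx, map_zero]
  have hX0 : algebraMap F K x ≠ 0 := by simpa using hx0
  set X := algebraMap F K x
  refine h ![X, -1, 0] ![0, X, -1] (LinearIndependent.pair_iff.2 fun s t hst => ?_) fun i => ?_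
  · have h0 := congrFun hst 0
    have h2 := congrFun hst 2
    simp [hX0] at h0 h2
    exact ⟨h0, h2⟩
  · simp only [Algebra.smul_def]
    fin_cases i
    · exact ⟨0, 1, by simp, by simp [cyclicPoints, dotProduct, Fin.sum_univ_three]⟩
    · exact ⟨x, -1, by simp, by simp [cyclicPoints, dotProduct, Fin.sum_univ_three, X]⟩
    · exact ⟨1, 0, by simp, by simp [cyclicPoints, dotProduct, Fin.sum_univ_three]⟩
    · exact ⟨1, 1, by simp, by simp [cyclicPoints, dotProduct, Fin.sum_univ_three]⟩
    · exact ⟨1, 0, by simp, by simp [cyclicPoints, dotProduct, Fin.sum_univ_three, X]⟩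
    · exact ⟨0, 1, by simp, by
        simp [cyclicPoints, dotProduct, Fin.sum_univ_three, X, mul_comm]⟩
    · refine ⟨-x, 1, by simp, ?_⟩
      have hX' : algebraMap F K x = X := rfl
      simp only [cyclicPoints, dotProduct, Fin.sum_univ_three, map_neg, map_one, hX']
      simp
      linear_combination (1 - X) * hX

theorem hasReducingPair_of_card_eq_three [CharP F 3] (hF : 2 < Nat.card F) {ξ : K} (hξ : ξ ≠ 0)
    (i : Fin 7) :    HasReducingPair F (cyclicPoints (-1) (-ξ)) i := by
  have : CharP K 3 := charP_of_injective_algebraMap (algebraMap F K).injective 3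
  have h3 : (3 : K) = 0 := by exact_mod_cast CharP.cast_eq_zero K 3
  refine hasReducingPair_cyclicPoints ?_ ?_ ?_ i
  -- The concurrent lines join the pairs `{1,2}, {3,5}, {4,6}`; for omitted index 3 they join
  -- `{0,6}, {1,5}, {2,4}`, and for 4, `{1,6}, {0,5}, {2,3}`.
  · refine hasReducingPair_of_concurrent hF (l₁ := ![ξ ^ 2, 0, 0]) (l₂ := ![1, 1 - ξ, 1 + ξ])
      (LinearIndependent.pair_iff.2 fun s t hst => ?_) fun i hi => ?_
    · have h0 := congrFun hst 0
      have h1 := congrFun hst 1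
      have h2 := congrFun hst 2
      simp at h0 h1 h2
      have ht : t = 0 := by
        rcases h1 with h1 | h1
        · exact h1
        · rcases h2 with h2 | h2
          · exact h2
          · exact absurd (show (1 : K) = 0 by linear_combination -h1 - h2 + h3) one_ne_zero
      simpa [ht, hξ] using h0
    · fin_cases i <;> simp [cyclicPoints, dotProduct, Fin.sum_univ_three] at hi ⊢ <;> grind
  · refine hasReducingPair_of_concurrent hF (l₁ := ![0, 1, ξ]) (l₂ := ![1, 0, -ξ])
      (LinearIndependent.pair_iff.2 fun s t hst => ?_) fun i hi => ?_
    · have h0 := congrFun hst 0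
      have h1 := congrFun hst 1
      simp at h0 h1
      exact ⟨h1, h0⟩
    · fin_cases i <;> simp [cyclicPoints, dotProduct, Fin.sum_univ_three] at hi ⊢
  · refine hasReducingPair_of_concurrent hF (l₁ := ![1, 0, 1]) (l₂ := ![0, -1, -1])
      (LinearIndependent.pair_iff.2 fun s t hst => ?_) fun i hi => ?_
    · have h0 := congrFun hst 0
      have h1 := congrFun hst 1
      simp at h0 h1
      exact ⟨h0, h1⟩
    · fin_cases i <;> simp [cyclicPoints, dotProduct, Fin.sum_univ_three] at hi ⊢

section FourElements

variable {ω η : K}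

theorem hasReducingPair_of_card_eq_four [CharP K 2] (hF : 2 < Nat.card F)
    (hω : ω ^ 2 + ω + 1 = 0) (hη : η ^ 2 = η + ω) (i : Fin 7) :
    HasReducingPair F (cyclicPoints η (1 + ω * η)) i := by
  have h2 : (2 : K) = 0 := by exact_mod_cast CharP.cast_eq_zero K 2
  have hω0 : ω ≠ 0 := by rintro rfl; simp at hω
  have hη0 : η ≠ 0 := by rintro rfl; simp at hη; exact hω0 hη.symm
  have hη1 : 1 + η ≠ 0 := fun h => hω0 (by grind)
  refine hasReducingPair_cyclicPoints ?_ ?_ ?_ i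
  -- Here the pairs are `{2,3}, {1,5}, {4,6}`; for omitted index 3, `{0,6}, {1,5}, {2,4}`; for 4,
  -- `{2,5}, {0,1}, {3,6}`. The scalar factors make the third equation the sum of the first two.
  · refine hasReducingPair_of_concurrent hF (l₁ := ![ω ^ 2 * η + ω, ω ^ 2 * η + ω, 0])
      (l₂ := ![η ^ 2, 0, η * (1 + ω * η)])
      (LinearIndependent.pair_iff.2 fun s t hst => ?_) fun i hi => ?_
    · have h0 := congrFun hst 0
      have h1 := congrFun hst 1
      simp at h0 h1
      have h3 : ω ^ 2 * η + ω ≠ 0 := fun h => by grind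
      have hs : s = 0 := by simpa [h3] using h1
      simpa [hs, hη0] using h0
    · fin_cases i <;> simp [cyclicPoints, dotProduct, Fin.sum_univ_three] at hi ⊢ <;> grind
  · refine hasReducingPair_of_concurrent hF (l₁ := ![0, 1, 1 + ω * η]) (l₂ := ![η, 0, 1 + ω * η])
      (LinearIndependent.pair_iff.2 fun s t hst => ?_) fun i hi => ?_
    · have h0 := congrFun hst 0
      have h1 := congrFun hst 1
      simp [hη0] at h0 h1
      exact ⟨h1, h0⟩
    · fin_cases i <;> simp [cyclicPoints, dotProduct, Fin.sum_univ_three] at hi ⊢ <;> grind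
  · refine hasReducingPair_of_concurrent hF
      (l₁ := ![ω * η, ω * η * (1 + ω * η), 0]) (l₂ := ![0, 0, 1 + ω * η + η])
      (LinearIndependent.pair_iff.2 fun s t hst => ?_) fun i hi => ?_
    · have h0 := congrFun hst 0
      have h1 := congrFun hst 2
      have h3 : 1 + ω * η + η ≠ 0 := fun h => by grind
      simp [hη0, hω0, h3] at h0 h1
      exact ⟨h0, h1⟩
    · fin_cases i <;> simp [cyclicPoints, dotProduct, Fin.sum_univ_three] at hi ⊢ <;> grind

end FourElements

end Specific

/-! ### Quadratic generators of `K`, and the set for `q = 4` -/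

section Pencils

variable {F K : Type*} [Field F] [Field K] [Algebra F K]

theorem exists_quadratic_root [Finite F] (hK : Module.finrank F K = 2) {τ n : F}
    (h : ∀ t : F, t ^ 2 ≠ τ * t - n) :
    ∃ ξ : K, ξ ∉ Set.range (algebraMap F K) ∧
      ξ ^ 2 = algebraMap F K τ * ξ - algebraMap F K n := by
  open Polynomial in
  let f : F[X] := X ^ 2 + (C (-τ) * X + C n)
  have hd : (C (-τ) * X + C n : F[X]).degree < 2 := degree_linear_lt
  have hm : f.Monic := monic_X_pow_add hd
  have hdeg : f.natDegree = 2 := by simp only [f]; compute_degree!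
  have hroots : f.roots = 0 := Multiset.eq_zero_of_forall_notMem fun t ht => h t (by
    have := (mem_roots'.1 ht).2
    simp only [f, IsRoot.def, eval_add, eval_pow, eval_X, eval_mul, eval_C] at this
    linear_combination this)
  have hirr : Irreducible f :=
    (hm.irreducible_iff_roots_eq_zero_of_degree_le_three (by omega) (by omega)).2 hroots
  have : Fact (Irreducible f) := ⟨hirr⟩
  have hfr : Module.finrank F (AdjoinRoot f) = 2 := by
    rw [(AdjoinRoot.powerBasis hirr.ne_zero).finrank, AdjoinRoot.powerBasis_dim, hdeg]
  have hfin : FiniteDimensional F K := Module.finite_of_finrank_pos (by omega)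
  have := Module.finite_of_finite F (M := K)
  obtain ⟨φ⟩ := FiniteField.nonempty_algHom_of_finrank_dvd
    (show Module.finrank F (AdjoinRoot f) ∣ Module.finrank F K by rw [hfr, hK])
  have hr : φ (AdjoinRoot.root f) ^ 2 = algebraMap F K τ * φ (AdjoinRoot.root f) -
      algebraMap F K n := by
    have h1 := congrArg φ (AdjoinRoot.aeval_eq f ▸ AdjoinRoot.mk_self (f := f) :
      aeval (AdjoinRoot.root f) f = 0)
    simp only [f, map_add, map_mul, map_pow, aeval_X, aeval_C, map_zero, AlgHom.commutes,
      map_neg] at h1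
    linear_combination h1
  refine ⟨_, ?_, hr⟩
  rintro ⟨t, ht⟩
  rw [← ht] at hr
  refine h t ((algebraMap F K).injective ?_)
  rw [map_sub, map_mul, map_pow, hr]

theorem eq_zero_of_conj_eq {σ : K →ₐ[F] K} {ξ : K} (hσ : σ ξ ≠ ξ) {z : K} {X Y : F}
    (hz : z = algebraMap F K X + algebraMap F K Y * ξ) (h : σ z = z) : Y = 0 := by
  rw [hz, map_add, map_mul, AlgHom.commutes, AlgHom.commutes] at h
  have h1 : algebraMap F K Y * (σ ξ - ξ) = 0 := by linear_combination h
  simpa [sub_ne_zero.2 hσ] using h1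

theorem noCone_of_card_eq_four [Finite F] (hK : Module.finrank F K = 2) [CharP F 2] (hF : Nat.card F = 4)
    {ω : F} (hω : ω ^ 2 + ω + 1 = 0) {η : K} (hη : η ^ 2 = η + algebraMap F K ω)
    (hη0 : η ∉ Set.range (algebraMap F K)) :
    NoCone F (cyclicPoints η (1 + algebraMap F K ω * η)) := by
  have two : (2 : F) = 0 := by exact_mod_cast CharP.cast_eq_zero F 2
  obtain ⟨σ, hσ, hconj⟩ := exists_conj (F := F) hK
  obtain ⟨hση, hne⟩ := hconj η 1 (-ω) hη0 (by rw [hη, map_one, map_neg]; ring)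
  rw [map_one] at hση
  have h4 (t : F) : t = 0 ∨ t = 1 ∨ t = ω ∨ t = ω + 1 := by
    have := Fintype.ofFinite F
    have h1 : t ^ 4 = t := by
      have := FiniteField.pow_card t
      rwa [← Nat.card_eq_fintype_card, hF] at this
    have h2 : t * (t - 1) * (t - ω) * (t - (ω + 1)) = 0 := by
      grind
    simp only [mul_eq_zero, sub_eq_zero] at h2
    tauto
  set w := algebraMap F K ω with hw
  have hw2 : w ^ 2 + w + 1 = 0 := by
    rw [hw, ← map_pow, ← map_add, ← map_one (algebraMap F K), ← map_add, hω, map_zero]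
  refine noCone_cyclicPoints σ hσ fun α β γ h1 hA hB hC hN => ?_
  obtain ⟨A, a, rfl⟩ := exists_eq_add_mul hK hη0 α
  obtain ⟨B, b, rfl⟩ := exists_eq_add_mul hK hη0 β
  obtain ⟨C, c, rfl⟩ := exists_eq_add_mul hK hη0 γ
  have hσw : σ w = w := σ.commutes ω
  have hσz : σ (1 + w * η) = 1 + w * (1 - η) := by
    rw [map_add, map_mul, map_one, hση, hσw]
  rw [hσz, hση] at hA hB hC
  -- Being fixed by `σ` means having zero `η`-coordinate, so each hypothesis becomes an equation
  -- over `F`: four linear ones and the cubic `eN`.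
  have e1 : a + b + c = 0 := eq_zero_of_conj_eq hne (X := A + B + C)
    (by simp only [map_add]; ring) h1
  have key (A a B b C c : F) (u : K) (hu : u = (algebraMap F K C + algebraMap F K c * η) * (1 - η) +
      (algebraMap F K A + algebraMap F K a * η) * (η * (1 + w * (1 - η))) +
      (algebraMap F K B + algebraMap F K b * η) * (1 + w * η)) (h : σ u = u) :
      -C + (A + (1 - ω ^ 2) * a) + (ω * B + (1 + ω) * b) = 0 := by
    refine eq_zero_of_conj_eq hne
      (X := (C - c * ω) + (-ω ^ 2 * A + a * ω) + (B + b * ω ^ 2)) ?_ h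
    simp only [map_add, map_mul, map_pow, map_sub, map_neg, map_one, ← hw]
    linear_combination hu + (-algebraMap F K c - w * (algebraMap F K A + algebraMap F K a * η) +
      algebraMap F K a + algebraMap F K b * w) * hη
  have eA := key A a B b C c _ (by ring) hA
  have eB := key B b C c A a _ (by ring) hB
  have eC := key C c A a B b _ (by ring) hC
  have eN : (A * B * c + A * b * C + a * B * C) + (a * b * C + a * B * c + A * b * c) +
      (1 + ω) * (a * b * c) = 0 := by
    refine eq_zero_of_conj_eq hne
      (X := A * B * C + ω * (a * b * C + a * B * c + A * b * c) + ω * (a * b * c)) ?_ hN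
    simp only [map_add, map_mul, map_one, ← hw]
    linear_combination (algebraMap F K a * algebraMap F K b * algebraMap F K C +
      algebraMap F K a * algebraMap F K B * algebraMap F K c +
      algebraMap F K A * algebraMap F K b * algebraMap F K c +
      algebraMap F K a * algebraMap F K b * algebraMap F K c * (η + 1)) * hη
  have hω0 : ω ≠ 0 := by rintro rfl; simp at hω
  have hs : A + B + C = 0 := by
    refine (mul_eq_zero.1 (?_ : ω * (A + B + C) = 0)).resolve_left hω0
    linear_combination eA + eB + eC - (2 - ω ^ 2 + ω) * e1
  have hB' : B = ω ^ 2 * a + b := by grind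
  have hC' : C = ω ^ 2 * b + c := by grind
  have hA' : A = ω ^ 2 * c + a := by grind
  have hc : c = a + b := by grind
  subst hA' hB' hC' hc
  -- What remains is a binary cubic form over GF(4); it is seen to be anisotropic by trying all
  -- sixteen pairs.
  have hab : a = 0 ∧ b = 0 := by
    rcases h4 a with rfl | rfl | rfl | rfl <;> rcases h4 b with rfl | rfl | rfl | rfl <;> grind
  obtain ⟨rfl, rfl⟩ := hab
  simp

end Pencils

/-! ### Cubics without roots and the determinant on the pencil -/

section Cubics

variable {F K : Type*} [Field F] [Finite F] [Field K] [Algebra F K]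

/-- The cubic `t³ - (c - 3) t² - c t - 1` has no root in `F` for a suitable `c`. -/
theorem exists_cubic_without_root (F : Type*) [Field F] [Finite F] :
    ∃ c : F, ∀ t : F, t ^ 3 + 3 * t ^ 2 - 1 ≠ c * (t ^ 2 + t) := by
  let f (t : F) : F := (t ^ 3 + 3 * t ^ 2 - 1) / (t ^ 2 + t)
  have hf : ¬ Function.Surjective f := fun hs => by
    -- Both values are 0 by division by zero; a non-injective self-map of a finite set misses some
    -- `c`.
    have h1 : f 0 = f (-1) := by simp [f]
    have := Finite.injective_iff_surjective.2 hs h1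
    simp at this
  simp only [Function.Surjective, not_forall, not_exists] at hf
  obtain ⟨c, hc⟩ := hf
  refine ⟨c, fun t ht => ?_⟩
  by_cases h0 : t ^ 2 + t = 0
  · have h1 : t * (t + 1) = 0 := by linear_combination h0
    rcases mul_eq_zero.1 h1 with h2 | h2
    · simp [h2] at ht
    · rw [eq_neg_of_add_eq_zero_left h2] at ht
      exact one_ne_zero (α := F) (by linear_combination ht)
  · exact hc t (by simp only [f]; rw [ht, mul_div_cancel_right₀ _ h0])

/-- The determinant on the pencil of skew-Hermitian forms vanishing on the seven points is, up to a
factor, the cubic form `v (a³ + 3a²b - b³) - u (a²b + ab²)`. -/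
theorem noCone_of_cubic_without_root (hK : Module.finrank F K = 2) {x τ n c : F} {ξ : K}
    (hξ : ξ ∉ Set.range (algebraMap F K))
    (hξ2 : ξ ^ 2 = algebraMap F K τ * ξ - algebraMap F K n)
    (hx0 : x ≠ 0) (hx1 : x ≠ 1) (hx : x ^ 2 + x + 1 ≠ 0)
    (hv : (x * τ - 1 - x) * (x - 1) * (τ * (x + 1) - 1) ≠ 0)
    (hu : 3 * ((x + τ) ^ 2 - (x * τ - 1 - x) ^ 2 - τ * (x ^ 2 + x + 1) * (x + τ)) +
      (τ ^ 2 - n) * (x ^ 2 + x + 1) ^ 2 =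
        c * ((x * τ - 1 - x) * (x - 1) * (τ * (x + 1) - 1)))
    (hc : ∀ t : F, t ^ 3 + 3 * t ^ 2 - 1 ≠ c * (t ^ 2 + t)) :
    NoCone F (cyclicPoints (algebraMap F K x) (ξ * algebraMap F K x)) := by
  obtain ⟨σ, hσ, hconj⟩ := exists_conj (F := F) hK
  obtain ⟨hσξ, hne⟩ := hconj ξ τ n hξ hξ2
  refine noCone_cyclicPoints σ hσ fun α β γ h1 hA hB hC hD => ?_
  obtain ⟨A, a, rfl⟩ := exists_eq_add_mul hK hξ α
  obtain ⟨B, b, rfl⟩ := exists_eq_add_mul hK hξ β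
  obtain ⟨C, d, rfl⟩ := exists_eq_add_mul hK hξ γ
  rw [map_mul, AlgHom.commutes, hσξ] at hA hB hC
  have e1 : a + b + d = 0 := eq_zero_of_conj_eq hne (X := A + B + C)
    (by simp only [map_add]; ring) h1
  have key (A a B b C d : F) (u : K)
      (hu : u = (algebraMap F K C + algebraMap F K d * ξ) * algebraMap F K x +
        (algebraMap F K A + algebraMap F K a * ξ) *
          (algebraMap F K x * ((algebraMap F K τ - ξ) * algebraMap F K x)) +
        (algebraMap F K B + algebraMap F K b * ξ) * (ξ * algebraMap F K x)) (h : σ u = u) :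
      d - x * A + B + b * τ = 0 := by
    refine (mul_eq_zero.1 (?_ : x * (d - x * A + B + b * τ) = 0)).resolve_left hx0
    refine eq_zero_of_conj_eq hne (X := x * (C + x * (τ * A + a * n) - b * n)) ?_ h
    simp only [map_add, map_mul, map_sub]
    linear_combination hu + (-algebraMap F K a * algebraMap F K x ^ 2 +
      algebraMap F K b * algebraMap F K x) * hξ2
  have eA := key A a B b C d _ (by ring) hA
  have eB := key B b C d A a _ (by ring) hB
  have eC := key C d A a B b _ (by ring) hC
  have eD : (A * B * d + A * b * C + a * B * C) + τ * (a * b * C + a * B * d + A * b * d) +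
      (τ ^ 2 - n) * (a * b * d) = 0 := by
    refine eq_zero_of_conj_eq hne
      (X := A * B * C - n * (a * b * C + a * B * d + A * b * d) - n * τ * (a * b * d)) ?_ hD
    simp only [map_add, map_mul, map_sub, map_pow]
    linear_combination (algebraMap F K a * algebraMap F K b * algebraMap F K C +
      algebraMap F K a * algebraMap F K B * algebraMap F K d +
      algebraMap F K A * algebraMap F K b * algebraMap F K d +
      algebraMap F K a * algebraMap F K b * algebraMap F K d * (ξ + algebraMap F K τ)) * hξ2
  have hs : A + B + C = 0 := by
    refine (mul_eq_zero.1 (?_ : (1 - x) * (A + B + C) = 0)).resolve_left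
      (sub_ne_zero.2 hx1.symm)
    linear_combination eA + eB + eC - (1 + τ) * e1
  have hd : d = -a - b := by linear_combination e1
  have hCe : C = -A - B := by linear_combination hs
  subst hd hCe
  -- The linear conditions are solved for `A` and `B`, the determinant being `x² + x + 1`; the
  -- pencil is thus parametrised by `(a, b)`.
  have fA : (x ^ 2 + x + 1) * A = -(x + τ) * a + (x * τ - 1 - x) * b := by
    linear_combination (-1 - x) * eA - eB
  have fB : (x ^ 2 + x + 1) * B = -(x + τ) * b + (x * τ - 1 - x) * (-a - b) := by
    linear_combination eA - x * eB
  have hcub : ((x * τ - 1 - x) * (x - 1) * (τ * (x + 1) - 1)) *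
      (a ^ 3 + 3 * a ^ 2 * b - b ^ 3 - c * (a ^ 2 * b + a * b ^ 2)) = 0 := by
    have h2 : (x ^ 2 + x + 1) ^ 2 * ((A * B * (-a - b) + A * b * (-A - B) + a * B * (-A - B)) +
      τ * (a * b * (-A - B) + a * B * (-a - b) + A * b * (-a - b)) +
      (τ ^ 2 - n) * (a * b * (-a - b))) = 0 := by rw [eD, mul_zero]
    generalize hNA : (x ^ 2 + x + 1) * A = NA at fA
    generalize hNB : (x ^ 2 + x + 1) * B = NB at fB
    have h3 : (NA * NB * (-a - b) + NA * b * (-NA - NB) + a * NB * (-NA - NB)) +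
      τ * (x ^ 2 + x + 1) * (a * b * (-NA - NB) + a * NB * (-a - b) + NA * b * (-a - b)) +
      (τ ^ 2 - n) * (x ^ 2 + x + 1) ^ 2 * (a * b * (-a - b)) = 0 := by
      rw [← hNA, ← hNB]
      linear_combination h2
    rw [fA, fB] at h3
    linear_combination h3 + (a * b * (a + b)) * hu
  have hcub' := (mul_eq_zero.1 hcub).resolve_left hv
  have hab : a = 0 ∧ b = 0 := by
    by_cases hb : b = 0
    · subst hb
      have : a ^ 3 = 0 := by linear_combination hcub'
      exact ⟨by simpa using this, rfl⟩
    -- Dehomogenising a zero with `b ≠ 0` would give a root of the excluded cubic.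
    · refine absurd ?_ (hc (a / b))
      field_simp
      linear_combination hcub'
  obtain ⟨rfl, rfl⟩ := hab
  have hA0 : A = 0 := by simpa [hx] using fA
  have hB0 : B = 0 := by simpa [hx] using fB
  subst hA0 hB0
  simp

end Cubics

/-! ### Choosing the parameters that realise a given `c` -/

section Parameters

theorem exists_avoiding_four {F : Type*} [Finite F] (hF : 8 ≤ Nat.card F) (u₁ u₂ u₃ u₄ : F) :
    ∃ x : F, x ≠ u₁ ∧ x ≠ u₂ ∧ x ≠ u₃ ∧ x ≠ u₄ := by
  classical
  have := Fintype.ofFinite F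
  obtain ⟨x, -, hx⟩ := Finset.exists_mem_notMem_of_card_lt_card
    (s := ({u₁, u₂, u₃, u₄} : Finset F)) (t := Finset.univ) (by
      rw [Finset.card_univ, ← Nat.card_eq_fintype_card]
      exact lt_of_le_of_lt Finset.card_le_four (by omega))
  simp at hx
  exact ⟨x, by tauto⟩

variable {F : Type*} [Field F] [Finite F]

/-- Otherwise `-D` is a square (take `y = 0`), so by scaling all sums of two squares are squares;
but a non-square is a sum of two squares. -/
theorem exists_not_isSquare_sq_sub (h2 : ringChar F ≠ 2) {D : F} (hD : D ≠ 0) :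
    ∃ y : F, ¬ IsSquare (y ^ 2 - D) := by
  have := Fintype.ofFinite F
  by_contra! hsq
  obtain ⟨s, hs⟩ := FiniteField.exists_nonsquare h2
  obtain ⟨e, he⟩ := hsq 0
  have he0 : e ≠ 0 := by rintro rfl; simp at he; exact hD he
  have hadd (y w : F) : IsSquare (y ^ 2 + w ^ 2) := by
    by_cases hw : w = 0
    · exact ⟨y, by rw [hw]; ring⟩
    obtain ⟨r, hr⟩ := hsq (y / (w / e))
    refine ⟨w / e * r, ?_⟩
    have h1 : w / e * r * (w / e * r) = (w / e) ^ 2 * (r * r) := by ring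
    rw [h1, ← hr]
    field_simp
    linear_combination -w ^ 2 * he
  obtain ⟨y, w, hyw⟩ := FiniteField.exists_root_sum_quadratic (R := F)
    (f := Polynomial.X ^ 2) (g := Polynomial.X ^ 2 - Polynomial.C s)
    (by simp) (by rw [Polynomial.degree_X_pow_sub_C (by norm_num)]; rfl)
    (FiniteField.odd_card_of_char_ne_two h2)
  simp at hyw
  exact hs (by
    have := hadd y w
    rwa [show y ^ 2 + w ^ 2 = s by linear_combination hyw] at this)

/-- The quadratic in `τ` is the discriminant `τ² - 4n` when `x = -1` and `n` is solved from the
relation between `u` and `c v`; it must be a non-square for `ξ` to lie outside `F`. -/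
theorem exists_parameter_odd (h2 : ringChar F ≠ 2) {c : F}
    (hc : ∀ t : F, t ^ 3 + 3 * t ^ 2 - 1 ≠ c * (t ^ 2 + t)) :
    ∃ τ : F, τ ≠ 0 ∧ ¬ IsSquare (9 * τ ^ 2 + (12 - 8 * c) * τ - 12) := by
  have := Fintype.ofFinite F
  have two : (2 : F) ≠ 0 := Ring.two_ne_zero h2
  by_cases h3 : (3 : F) = 0
  · obtain ⟨s, hs⟩ := FiniteField.exists_nonsquare h2
    have hs0 : s ≠ 0 := by rintro rfl; simp at hs
    have hc0 : c ≠ 0 := by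
      rintro rfl
      exact hc 1 (by linear_combination h3)
    refine ⟨s / c, div_ne_zero hs0 hc0, ?_⟩
    have h1 : 9 * (s / c) ^ 2 + (12 - 8 * c) * (s / c) - 12 = s := by
      have h4 : c * (s / c) = s := by field_simp
      linear_combination (3 * (s / c) ^ 2 + 4 * (s / c) - 4 - 3 * s) * h3 - 8 * h4
    rwa [h1]
  by_cases hsq : IsSquare (-3 : F)
  -- Completing the square leaves this constant. The cubic has discriminant `(c² - 3c + 9)²`, and if
  -- that vanished `(c - 3) / 3` would be a triple root.
  · have hD : 16 / 9 * (c ^ 2 - 3 * c + 9) ≠ 0 := by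
      intro h0
      have h9 : (9 : F) ≠ 0 := by
        rw [show (9 : F) = 3 * 3 by norm_num]; exact mul_ne_zero h3 h3
      have h16 : (16 : F) ≠ 0 := by
        rw [show (16 : F) = 2 ^ 4 by norm_num]; exact pow_ne_zero _ two
      have h1 : c ^ 2 - 3 * c + 9 = 0 :=
        (mul_eq_zero.1 h0).resolve_left (div_ne_zero h16 h9)
      refine hc ((c - 3) / 3) ?_
      field_simp
      linear_combination (-2 * c + 3) * h1
    obtain ⟨y, hy⟩ := exists_not_isSquare_sq_sub h2 hD
    have h1 : 9 * ((y - 2 + 4 * c / 3) / 3) ^ 2 + (12 - 8 * c) * ((y - 2 + 4 * c / 3) / 3) - 12 =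
        y ^ 2 - 16 / 9 * (c ^ 2 - 3 * c + 9) := by
      have h9 : (9 : F) ≠ 0 := by
        rw [show (9 : F) = 3 * 3 by norm_num]; exact mul_ne_zero h3 h3
      field_simp
      ring
    refine ⟨(y - 2 + 4 * c / 3) / 3, fun h0 => hy ?_, by rwa [h1]⟩
    rw [← h1, h0]
    obtain ⟨r, hr⟩ := hsq
    exact ⟨2 * r, by linear_combination 4 * hr⟩
  · have h9 : (9 : F) ≠ 0 := by
      rw [show (9 : F) = 3 * 3 by norm_num]; exact mul_ne_zero h3 h3
    -- Like `τ = 0`, this `τ` gives the value `-12`, a non-square together with `-3`. It is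
    -- non-zero, since for `2c = 3` the cubic has the root `-1/2`.
    refine ⟨(8 * c - 12) / 9, fun h0 => ?_, fun hs => hsq ?_⟩
    · have h1 : 8 * c - 12 = 0 := by simpa [h9] using h0
      have h4 : (4 : F) ≠ 0 := by
        rw [show (4 : F) = 2 * 2 by norm_num]; exact mul_ne_zero two two
      have h5 : 2 * c = 3 := mul_left_cancel₀ h4 (by linear_combination h1)
      refine hc (-1 / 2) ?_
      field_simp
      linear_combination h5
    · obtain ⟨r, hr⟩ := hs
      refine ⟨r / 2, ?_⟩
      have h1 : 9 * ((8 * c - 12) / 9) ^ 2 + (12 - 8 * c) * ((8 * c - 12) / 9) - 12 = (-12 : F) := by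
        field_simp
        ring
      rw [h1] at hr
      field_simp
      linear_combination hr

/-- The map `z ↦ z² + z` is two-to-one, so at most `q/2 + 3 < q` values of `y` are forbidden. -/
theorem exists_affine_notMem_range [CharP F 2] (hF : 8 ≤ Nat.card F) {k₀ k₁ : F} (hk : k₁ ≠ 0)
    (u₁ u₂ u₃ : F) :
    ∃ y : F, y ≠ u₁ ∧ y ≠ u₂ ∧ y ≠ u₃ ∧ ∀ z : F, z ^ 2 + z ≠ k₀ + k₁ * y := by
  classical
  have := Fintype.ofFinite F
  let I : Finset F := Finset.univ.image fun z : F => z ^ 2 + z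
  have hI : I.card * 2 ≤ Fintype.card F := by
    rw [← Finset.card_univ]
    rw [mul_comm]
    refine Finset.mul_card_image_le_card _ 2 fun i hi => ?_
    obtain ⟨z, -, rfl⟩ := Finset.mem_image.1 hi
    have two : (2 : F) = 0 := by exact_mod_cast CharP.cast_eq_zero F 2
    refine (Finset.card_pair (show z ≠ z + 1 by simp)).symm.le.trans
      (Finset.card_le_card fun w hw => ?_)
    rcases Finset.mem_insert.1 hw with rfl | hw
    · simp
    · rw [Finset.mem_singleton.1 hw]
      simp only [Finset.mem_filter, Finset.mem_univ, true_and]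
      linear_combination (z + 1) * two
  let J := I.image fun i => (i - k₀) / k₁
  have hJ : J.card ≤ I.card := Finset.card_image_le
  obtain ⟨y, -, hy⟩ := Finset.exists_mem_notMem_of_card_lt_card
    (s := ({u₁, u₂, u₃} : Finset F) ∪ J) (t := Finset.univ) (by
      have h1 := Finset.card_union_le ({u₁, u₂, u₃} : Finset F) J
      have h2 : ({u₁, u₂, u₃} : Finset F).card ≤ 3 := Finset.card_le_three
      rw [Nat.card_eq_fintype_card] at hF
      rw [Finset.card_univ]
      omega)
  simp only [Finset.mem_union, Finset.mem_insert, Finset.mem_singleton, not_or] at hy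
  refine ⟨y, hy.1.1, hy.1.2.1, hy.1.2.2, fun z hz => hy.2 ?_⟩
  refine Finset.mem_image.2 ⟨_, Finset.mem_image_of_mem _ (Finset.mem_univ z), ?_⟩
  rw [hz]
  field_simp
  ring

theorem exists_parameter_even [CharP F 2] (hF : 8 ≤ Nat.card F) {c : F}
    (hc : ∀ t : F, t ^ 3 + 3 * t ^ 2 - 1 ≠ c * (t ^ 2 + t)) :
    ∃ x τ n : F, x ≠ 0 ∧ x ≠ 1 ∧ x ^ 2 + x + 1 ≠ 0 ∧
      (x * τ - 1 - x) * (x - 1) * (τ * (x + 1) - 1) ≠ 0 ∧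
      3 * ((x + τ) ^ 2 - (x * τ - 1 - x) ^ 2 - τ * (x ^ 2 + x + 1) * (x + τ)) +
        (τ ^ 2 - n) * (x ^ 2 + x + 1) ^ 2 =
          c * ((x * τ - 1 - x) * (x - 1) * (τ * (x + 1) - 1)) ∧
      ∀ t : F, t ^ 2 ≠ τ * t - n := by
  have := Fintype.ofFinite F
  have two : (2 : F) = 0 := by exact_mod_cast CharP.cast_eq_zero F 2
  obtain ⟨x, hx0, hx1, hx⟩ : ∃ x : F, x ≠ 0 ∧ x ≠ 1 ∧ x ^ 2 + x + 1 ≠ 0 := by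
    obtain ⟨x, h0, h1, -, -⟩ := exists_avoiding_four hF (0 : F) 1 0 1
    by_cases hx : x ^ 2 + x + 1 = 0
    · obtain ⟨z, hz0, hz1, hz2, hz3⟩ := exists_avoiding_four hF (0 : F) 1 x (x + 1)
      refine ⟨z, hz0, hz1, fun hz => ?_⟩
      have h3 : (z - x) * (z - (x + 1)) = 0 := by
        linear_combination hz - hx + (- z - x * z + x ^ 2 + x) * two
      rcases mul_eq_zero.1 h3 with h | h
      · exact hz2 (sub_eq_zero.1 h)
      · exact hz3 (sub_eq_zero.1 h)
    · exact ⟨x, h0, h1, hx⟩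
  have hx1' : x + 1 ≠ 0 := fun h => hx1 (by linear_combination h - two)
  -- With `y = τ⁻¹` and `n` solved from the required relation, `r² / N²` is the coefficient of `y²`
  -- in `n * y²`; substituting `z = t * y + r * y / N` removes that term and leaves `z² + z` equal
  -- to an affine function of `y`.
  obtain ⟨r, hr⟩ := FiniteField.isSquare_of_char_two (ringChar.eq_iff.2 ‹_›) (c * (x + 1) ^ 2 + 1)
  have hc1 : c ^ 2 + c + 1 ≠ 0 := fun h => hc (c + 1) (by grind)
  have hk : r + c * (x + 1) + x ≠ 0 := by
    intro h
    have h1 : (x + 1) ^ 2 * (c ^ 2 + c + 1) = 0 := by grind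
    exact (mul_ne_zero (pow_ne_zero 2 hx1') hc1) h1
  set N := x ^ 2 + x + 1 with hN
  -- The two non-zero excluded values are those at which a factor of `v` containing `τ` vanishes.
  obtain ⟨y, hy0, hy1, hy2, hy⟩ := exists_affine_notMem_range hF
    (k₀ := 1 + (c * (x + 1) ^ 2 + 1) * x / N ^ 2) (div_ne_zero hk hx) 0 (x / (x + 1)) (x + 1)
  refine ⟨x, y⁻¹, (y⁻¹) ^ 2 + (3 * ((x + y⁻¹) ^ 2 - (x * y⁻¹ - 1 - x) ^ 2 - y⁻¹ * N * (x + y⁻¹)) -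
    c * ((x * y⁻¹ - 1 - x) * (x - 1) * (y⁻¹ * (x + 1) - 1))) / N ^ 2, hx0, hx1, hx, ?_, ?_, ?_⟩
  · refine mul_ne_zero (mul_ne_zero (fun h => hy1 ?_) (sub_ne_zero.2 hx1)) fun h => hy2 ?_
    · field_simp at h ⊢
      linear_combination -h
    · field_simp at h
      linear_combination -h
  · field_simp
    ring
  · intro t ht
    refine hy (t * y + r * y / N) ?_
    field_simp at ht ⊢
    clear hy hc hy1 hy2 hk hc1 hx0 hx1 hx1' hy0 hx
    grind

end Parameters

/-! ### Assembling the cases of `q` -/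

section Existence

variable {F K : Type*} [Field F] [Finite F] [Field K] [Algebra F K]

theorem exists_noCone_of_parameters (hK : Module.finrank F K = 2) {x τ n c : F}
    (hx0 : x ≠ 0) (hx1 : x ≠ 1) (hx : x ^ 2 + x + 1 ≠ 0)
    (hv : (x * τ - 1 - x) * (x - 1) * (τ * (x + 1) - 1) ≠ 0)
    (hu : 3 * ((x + τ) ^ 2 - (x * τ - 1 - x) ^ 2 - τ * (x ^ 2 + x + 1) * (x + τ)) +
      (τ ^ 2 - n) * (x ^ 2 + x + 1) ^ 2 =
        c * ((x * τ - 1 - x) * (x - 1) * (τ * (x + 1) - 1)))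
    (hc : ∀ t : F, t ^ 3 + 3 * t ^ 2 - 1 ≠ c * (t ^ 2 + t))
    (hn : ∀ t : F, t ^ 2 ≠ τ * t - n) :
    ∃ (x : F) (ξ : K), IsAdmissible x ξ := by
  obtain ⟨ξ, hξ, hξ2⟩ := exists_quadratic_root hK hn
  refine ⟨x, ξ, hx0, hx1, hξ, ?_⟩
  rw [pointSet_eq_range]
  exact (noCone_of_cubic_without_root hK hξ hξ2 hx0 hx1 hx hv hu hc).isSevenSet hK _

theorem exists_isAdmissible (hK : Module.finrank F K = 2) (hF : 2 < Nat.card F)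
    (hF4 : Nat.card F ≠ 4) : ∃ (x : F) (ξ : K), IsAdmissible x ξ := by
  have := Fintype.ofFinite F
  obtain ⟨c, hc⟩ := exists_cubic_without_root F
  by_cases h2 : ringChar F = 2
  · have : CharP F 2 := ringChar.eq_iff.1 h2
    have h8 : 8 ≤ Nat.card F := by
      obtain ⟨m, -, hm⟩ := FiniteField.card F 2
      rw [Nat.card_eq_fintype_card, hm] at hF hF4 ⊢
      have hm3 : 3 ≤ (m : ℕ) := by
        by_contra! hlt
        interval_cases (m : ℕ) <;> omega
      exact Nat.pow_le_pow_right two_pos hm3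
    obtain ⟨x, τ, n, hx0, hx1, hx, hv, hu, hn⟩ := exists_parameter_even h8 hc
    exact exists_noCone_of_parameters hK hx0 hx1 hx hv hu hc hn
  · have two : (2 : F) ≠ 0 := Ring.two_ne_zero h2
    obtain ⟨τ, hτ, hsq⟩ := exists_parameter_odd h2 hc
    refine exists_noCone_of_parameters hK (x := -1) (τ := τ)
      (n := 3 - 3 * τ - 2 * τ ^ 2 + 2 * c * τ) (by simp)
      (fun h => two (by linear_combination -h)) (by norm_num) ?_ (by ring) hc fun t ht => hsq ?_
    · have : (-1 * τ - 1 - -1) * (-1 - 1) * (τ * (-1 + 1) - 1) = -(2 * τ) := by ring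
      rw [this]
      exact neg_ne_zero.2 (mul_ne_zero two hτ)
    · exact ⟨2 * t - τ, by linear_combination -4 * ht⟩

/-- For `q = 3` necessarily `x = -1`; for `q = 4` every `x ≠ 0, 1` is a root of `x² + x + 1`,
contradicting `NoCone`; otherwise the dimension count applies. -/
theorem hasReducingPair_of_isAdmissible (hK : Module.finrank F K = 2) (hF : 2 < Nat.card F)
    {x : F} {ξ : K} (h : IsAdmissible x ξ)
    (hS : NoCone F (cyclicPoints (algebraMap F K x) (ξ * algebraMap F K x))) (i : Fin 7) :
    HasReducingPair F (cyclicPoints (algebraMap F K x) (ξ * algebraMap F K x)) i := by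
  have := Fintype.ofFinite F
  obtain ⟨hx0, hx1, hξ, -⟩ := h
  obtain h3 | h4 | h5 : Nat.card F = 3 ∨ Nat.card F = 4 ∨ 5 ≤ Nat.card F := by omega
  · have : CharP F 3 := charP_of_card_eq_prime (by rw [← Nat.card_eq_fintype_card, h3])
    have h1 := FiniteField.pow_card_sub_one_eq_one x hx0
    rw [← Nat.card_eq_fintype_card, h3] at h1
    have hx : x = -1 := by
      have h2 : (x - 1) * (x + 1) = 0 := by linear_combination h1
      exact eq_neg_of_add_eq_zero_left ((mul_eq_zero.1 h2).resolve_left (sub_ne_zero.2 hx1))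
    have hξ0 : ξ ≠ 0 := by rintro rfl; exact hξ ⟨0, map_zero _⟩
    have := hasReducingPair_of_card_eq_three (F := F) hF hξ0 i
    simpa [hx] using this
  · refine absurd hS (not_noCone_of_root ?_ ξ)
    have h1 := FiniteField.pow_card_sub_one_eq_one x hx0
    rw [← Nat.card_eq_fintype_card, h4] at h1
    have h2 : (x - 1) * (x ^ 2 + x + 1) = 0 := by linear_combination h1
    exact (mul_eq_zero.1 h2).resolve_left (sub_ne_zero.2 hx1)
  · exact hS.hasReducingPair hK h5 i

theorem exists_sevenSet_of_card_eq_four [DecidableEq F] (hK : Module.finrank F K = 2)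
    (hF : Nat.card F = 4) :
    ∃ S : Set (ℙ K (Fin 3 → K)), IsSevenSet F S ∧ GivesSevenLinesCode F S := by
  have := Fintype.ofFinite F
  have hF' : Fintype.card F = 4 := by rw [← Nat.card_eq_fintype_card, hF]
  have : CharP F 2 := charP_of_card_eq_prime_pow (f := 2) (by rw [hF']; rfl)
  have two : (2 : F) = 0 := by exact_mod_cast CharP.cast_eq_zero F 2
  obtain ⟨ω, hω⟩ : ∃ ω : F, ω ^ 2 + ω + 1 = 0 := by
    obtain ⟨x, -, hx⟩ := Finset.exists_mem_notMem_of_card_lt_card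
      (s := ({0, 1} : Finset F)) (t := Finset.univ) (by
        rw [Finset.card_univ, hF']
        exact lt_of_le_of_lt Finset.card_le_two (by norm_num))
    simp only [Finset.mem_insert, Finset.mem_singleton, not_or] at hx
    have h1 := FiniteField.pow_card_sub_one_eq_one x hx.1
    rw [hF'] at h1
    have h2 : (x - 1) * (x ^ 2 + x + 1) = 0 := by linear_combination h1
    exact ⟨x, (mul_eq_zero.1 h2).resolve_left (sub_ne_zero.2 hx.2)⟩
  -- If `t² = t + ω` in GF(4), then `t⁴ = t + ω + ω² = t + 1`, whereas `t⁴ = t`.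
  obtain ⟨η, hη, hη2⟩ := exists_quadratic_root hK (τ := 1) (n := -ω) fun t ht => by
    have h1 := FiniteField.pow_card t
    rw [hF'] at h1
    exact one_ne_zero (α := F) (by grind)
  have hη3 : η ^ 2 = η + algebraMap F K ω := by
    rw [hη2, map_one, map_neg]
    ring
  have : CharP K 2 := charP_of_injective_algebraMap (algebraMap F K).injective 2
  have hω' : algebraMap F K ω ^ 2 + algebraMap F K ω + 1 = 0 := by
    rw [← map_pow, ← map_add, ← map_one (algebraMap F K), ← map_add, hω, map_zero]
  have hS := noCone_of_card_eq_four hK hF hω hη3 hη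
  exact ⟨_, hS.isSevenSet hK (cyclicPoints_ne_zero _ _), givesSevenLinesCode_range hK (by omega)
    _ hS (hasReducingPair_of_card_eq_four (by omega) hω' hη3)⟩

end Existence

end SevenLines

theorem mainTheorem8 {F K : Type*} [Field F] [Finite F] [DecidableEq F] [Field K] [Algebra F K]
    (hK : Module.finrank F K = 2) (hq : 2 < Nat.card F) :
    (∀ (x : F) (ξ : K), SevenLines.IsAdmissible x ξ →
      SevenLines.GivesSevenLinesCode F (SevenLines.pointSet x ξ)) ∧
    (Nat.card F ≠ 4 → ∃ (x : F) (ξ : K), SevenLines.IsAdmissible x ξ) ∧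
    (Nat.card F = 4 → ∃ S : Set (ℙ K (Fin 3 → K)),
      SevenLines.IsSevenSet F S ∧ SevenLines.GivesSevenLinesCode F S) := by
  refine ⟨fun x ξ h => ?_, SevenLines.exists_isAdmissible hK hq,
    SevenLines.exists_sevenSet_of_card_eq_four hK⟩
  have hS := h.2.2.2
  rw [SevenLines.pointSet_eq_range] at hS ⊢
  exact SevenLines.givesSevenLinesCode_range hK hq _ (hS.noCone _)
    (SevenLines.hasReducingPair_of_isAdmissible hK hq h (hS.noCone _))
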